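/- **Model.** Let $d\ge 1$, let $G=(V,E)$ be a simple graph on $V=[d]$, and let $\widetilde E=E\cup\{\{j\}:j\in V\}$. The change points $\lambda_1,\dots,\lambda_d$ are independent with priors $\pi_1,\dots,\pi_d$ on $\mathbb N=\{1,2,\dots\}$; for $e\in\widetilde E$ put $\lambda_e=\min_{j\in e}\lambda_j$. For every $e\in\widetilde E$ let $f_e,g_e$ be probability densities with respect to a $\sigma$-finite measure $\mu$. Given $\lambda_*=(\lambda_1,\dots,\lambda_d)$, all observations $X_e^t$ ($e\in\widetilde E$, $t\in\mathbb N$) are independent, and $X_e^t$ has density $g_e$ if $t<\lambda_e$ and $f_e$ if $t\ge\lambda_e$. Let $\mathbf X_*^n=(X_e^t)_{e\in\widetilde E,\,t\le n}$ and $\mathcal F_n=\sigma(\mathbf X_*^n)$. Let $\emptyset\ne\mathcal S\subset[d]$, $\phi=\lambda_{\mathcal S}=\min_{j\in \mathcal S}\lambda_j$, $I_e=\int f_e\log\frac{f_e}{g_e}\,d\mu$ (the Kullback–Leibler divergence) and $I_\phi=\sum_{e\in\widetilde E,\ e\subset\mathcal S}I_e$. Assume $I_\phi>0$. Write $\mathbb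 P_\phi^k=\mathbb P(\cdot\mid\phi=k)$, $\mathbb E_\phi^k$ for its expectation, $\mathbb P_{\lambda_*}^{m_*}=\mathbb P(\cdot\mid\lambda_*=m_*)$, $\pi_\phi^k(m_*)=\mathbb P(\lambda_*=m_*\mid\phi=k)$, and $$D_\phi^{k,n}=\frac{P(\mathbf X_*^n\mid\phi=k)}{P(\mathbf X_*^n\mid\phi=\infty)},$$ a ratio of densities, where under $\phi=\infty$ we have $\lambda_j=\infty$ (no change) for $j\in\mathcal S$, while $\lambda_j$, $j\notin\mathcal S$, are independent with laws $\pi_j$. **Lemma.** Assume that there are $\varepsilon_0>0$, $c_1>0$ and polynomials $p$ (in $m_1,\dots,m_d,k$) and $q$ (in $n$) with constant nonnegative coefficients such that for all $k\in\mathbb N$ and all $m_*\in\mathbb N^d$ with $\pi_\phi^k(m_*)>0$, $$\mathbb P_{\lambda_*}^{m_*}\Big\{\Big|\frac1n\log D_\phi^{k,n}-I_\phi\Big|>\varepsilon\Big\}\le q(n)\exp(-c_1n\varepsilon^2)$$ for all $n\in\mathbb N$ and $\varepsilon\in(0,\varepsilon_0)$ such that $\sqrt n\ge\frac1\varepsilon\,p(m_*,k)$.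 Assume also that $\pi_\phi^k$ (for every $k$) and the law of $\phi$ have finite polynomial moments. Then: 1. for all $\varepsilon>0$ and $k\in\mathbb N$ with $\mathbb P(\phi=k)>0$, $$\mathbb P_\phi^k\Big[\frac1N\max_{1\le n\le N}\log D_\phi^{k,k+n}\ge(1+\varepsilon)I_\phi\Big]\longrightarrow0\quad\text{as }N\to\infty;$$ 2. for all $\varepsilon>0$, with $T_\varepsilon^k=\sup\{n\in\mathbb N:\frac1n\log D_\phi^{k,k+n-1}<I_\phi-\varepsilon\}$ (and $\sup\emptyset=0$), $$\mathbb E\,T_\varepsilon^\phi:=\sum_{k=1}^\infty\mathbb P(\phi=k)\,\mathbb E_\phi^k(T_\varepsilon^k)<\infty;$$ 3. (optimal delay) suppose moreover that the priors are geometric, $\pi_j(k)=(1-\rho_j)^{k-1}\rho_j$ with $\rho_j\in(0,1)$, and that $\|\log\frac{f_e}{g_e}\|_\infty\le M$ for all $e\in\widetilde E$ and some constant $M$. Let $q_\phi=-\log\prod_{j\in\mathcal S}(1-\rho_j)$ and $\tau_{\mathcal S}=\inf\{n\in\mathbb N:\mathbb P(\phi\le n\mid\mathbf X_*^n)\ge1-\alpha\}$,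 and let $\Delta_\phi(\alpha)$ be the set of all stopping times $\tau$ of $(\mathcal F_n)_{n\ge0}$ with $\mathbb P(\tau\le\phi)\le\alpha$. Then, as $\alpha\downarrow0$, $$\mathbb E[\tau_{\mathcal S}-\phi\mid\tau_{\mathcal S}\ge\phi]=\frac{|\log\alpha|}{q_\phi+I_\phi}(1+o(1))\quad\text{and}\quad\inf_{\widetilde\tau\in\Delta_\phi(\alpha)}\mathbb E[\widetilde\tau-\phi\mid\widetilde\tau\ge\phi]=\frac{|\log\alpha|}{q_\phi+I_\phi}(1+o(1)).$$ -/

import Mathlib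

open MeasureTheory ProbabilityTheory Filter Topology
open scoped ENNReal NNReal

namespace ChangePoint

/-- The extended edge set of a statistical graph: its edges together with all self-loops
`s(j, j)`. A self-loop stands for the vertex `j` and carries the private data of sensor `j`. -/
abbrev ExtEdge {d : ℕ} (G : SimpleGraph (Fin d)) : Type :=
  {e : Sym2 (Fin d) // e.IsDiag ∨ e ∈ G.edgeSet}

noncomputable instance {d : ℕ} (G : SimpleGraph (Fin d)) : Fintype (ExtEdge G) :=
  Fintype.ofFinite _

/-- Data of the graphical change point model with `d` sensors: a statistical graph, a prior on the
positive integers for every change point, and pre-change densities `g e` and post-change densities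
`f e` with respect to a common dominating measure `μ`. -/
structure Model (d : ℕ) (𝓧 : Type*) [MeasurableSpace 𝓧] where
  graph : SimpleGraph (Fin d)
  prior : Fin d → PMF ℕ
  prior_zero : ∀ j, prior j 0 = 0
  μ : Measure 𝓧
  sigmaFinite : SigmaFinite μ
  f : ExtEdge graph → 𝓧 → ℝ≥0
  g : ExtEdge graph → 𝓧 → ℝ≥0
  measurable_f : ∀ e, Measurable (f e)
  measurable_g : ∀ e, Measurable (g e)
  lintegral_f : ∀ e, ∫⁻ x, (f e x : ℝ≥0∞) ∂μ = 1
  lintegral_g : ∀ e, ∫⁻ x, (g e x : ℝ≥0∞) ∂μ = 1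

namespace Model

variable {d : ℕ} {𝓧 : Type*} [MeasurableSpace 𝓧] (A : Model d 𝓧)

/-- Sample paths of all observations: `x (e, t)` is the observation attached to `e` at the
time `t + 1`. -/
abbrev Obs : Type _ := ExtEdge A.graph × ℕ → 𝓧

/-- Sample space: change points together with all the observations. -/
abbrev Sample : Type _ := (Fin d → ℕ) × A.Obs

/-- `λ_e`, the minimum of the two change points at the endpoints of `e`. The value `∞` stands for
a change that never happens. -/
noncomputable def edgeMin (m : Fin d → ℕ∞) (e : ExtEdge A.graph) : ℕ∞ := (e.1.map m).inf

open Classical in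
/-- The density of the observation attached to `e` at time `t + 1`, given the change points `m`. -/
noncomputable def obsDensity (m : Fin d → ℕ∞) (p : ExtEdge A.graph × ℕ) : 𝓧 → ℝ≥0 :=
  if ((p.2 + 1 : ℕ) : ℕ∞) < A.edgeMin m p.1 then A.g p.1 else A.f p.1

/-- The law of all the observations given the change points `m`: they are independent. -/
noncomputable def obsLaw (m : Fin d → ℕ∞) : Measure A.Obs :=
  Measure.infinitePi fun p => A.μ.withDensity fun x => (A.obsDensity m p x : ℝ≥0∞)

/-- The joint law of the change points and of all the observations. -/
noncomputable def law : Measure A.Sample :=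
  Measure.sum fun m : Fin d → ℕ =>
    (∏ j, A.prior j (m j)) • (Measure.dirac m).prod (A.obsLaw fun j => (m j : ℕ∞))

/-- The observations up to time `n` generate the `n`-th σ-algebra. -/
def filtration : Filtration ℕ (inferInstance : MeasurableSpace A.Sample) where
  seq n := ⨆ (e : ExtEdge A.graph) (t : ℕ) (_ : t < n),
    MeasurableSpace.comap (fun ω : A.Sample => ω.2 (e, t)) inferInstance
  mono' _ _ h := iSup_mono fun _ => iSup_mono fun _ => iSup_mono' fun ht =>
    ⟨lt_of_lt_of_le ht h, le_rfl⟩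
  le' _ := iSup_le fun e => iSup_le fun t => iSup_le fun _ =>
    Measurable.comap_le ((measurable_pi_apply (e, t)).comp measurable_snd)

/-- The event `λ_* = m`. -/
def lamEq (m : Fin d → ℕ) : Set A.Sample := {ω | ω.1 = m}

section Functional

variable (S : Finset (Fin d)) (hS : S.Nonempty)

/-- The delay functional `φ = λ_S = min_{j ∈ S} λ_j`. -/
def phi (ω : A.Sample) : ℕ := S.inf' hS ω.1

/-- The event `φ = k`. -/
def phiEq (k : ℕ) : Set A.Sample := {ω | A.phi S hS ω = k}

/-- The conditional law given `φ = k`. -/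
noncomputable def lawPhi (k : ℕ) : Measure A.Sample := cond A.law (A.phiEq S hS k)

/-- The conditional law given `λ_* = m`. -/
noncomputable def lawLam (m : Fin d → ℕ) : Measure A.Sample := cond A.law (A.lamEq m)

/-- `π_φ^k(m) = P(λ_* = m | φ = k)`. -/
noncomputable def piPhi (k : ℕ) (m : Fin d → ℕ) : ℝ≥0∞ := A.lawPhi S hS k (A.lamEq m)

/-- `P(X_*^n | λ_* = m)`, the density of the observations up to time `n` given the change points,
with respect to the product of copies of `μ`. -/
noncomputable def likelihood (n : ℕ) (m : Fin d → ℕ∞) (x : A.Obs) : ℝ≥0∞ :=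
  ∏ e : ExtEdge A.graph, ∏ t ∈ Finset.range n, (A.obsDensity m (e, t) (x (e, t)) : ℝ≥0∞)

/-- `P(X_*^n | φ = k)`. -/
noncomputable def likPhi (k n : ℕ) (x : A.Obs) : ℝ≥0∞ :=
  ∑' m : Fin d → ℕ, A.piPhi S hS k m * A.likelihood n (fun j => (m j : ℕ∞)) x

open Classical in
/-- `P(X_*^n | φ = ∞)`: no change ever happens on `S`, while the other change points
are independent and follow their priors. -/
noncomputable def likInfty (n : ℕ) (x : A.Obs) : ℝ≥0∞ :=
  ∑' m : Fin d → ℕ, (∏ j, A.prior j (m j)) *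
    A.likelihood n (fun j => if j ∈ S then ⊤ else (m j : ℕ∞)) x

/-- The marginal likelihood ratio `D_φ^{k,n}`. -/
noncomputable def D (k n : ℕ) (ω : A.Sample) : ℝ≥0∞ :=
  A.likPhi S hS k n ω.2 / A.likInfty S n ω.2

/-- `I_e`, the Kullback-Leibler divergence between `f_e` and `g_e`. -/
noncomputable def edgeInfo (e : ExtEdge A.graph) : ℝ≥0∞ :=
  InformationTheory.klDiv (A.μ.withDensity fun x => (A.f e x : ℝ≥0∞))
    (A.μ.withDensity fun x => (A.g e x : ℝ≥0∞))

open Classical in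
/-- `I_φ`, the sum of `I_e` over all extended edges `e ⊆ S`. -/
noncomputable def info : ℝ≥0∞ :=
  ∑ e : ExtEdge A.graph with ∀ j ∈ e.1, j ∈ S, A.edgeInfo e

/-- `‖log (f_e / g_e)‖_∞ ≤ M` for all extended edges `e`, where the supremum is the essential one
over the points at which `f_e` and `g_e` do not both vanish. -/
def BoundedLLR (M : ℝ) : Prop :=
  ∀ e, ∀ᵐ x ∂A.μ, (A.f e x ≠ 0 ∨ A.g e x ≠ 0) →
    (ENNReal.log ((A.f e x : ℝ≥0∞) / (A.g e x : ℝ≥0∞))).abs ≤ ENNReal.ofReal M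

/-- The priors are geometric with parameters `ρ j ∈ (0,1)`. -/
def GeometricPriors (ρ : Fin d → ℝ) : Prop :=
  ∀ j, ρ j ∈ Set.Ioo (0 : ℝ) 1 ∧
    ∀ k, 1 ≤ k → A.prior j k = ENNReal.ofReal ((1 - ρ j) ^ (k - 1) * ρ j)

/-- All polynomial moments of `π_φ^k` are finite, for every `k`. -/
def PiPhiMoments : Prop :=
  ∀ k r : ℕ, ∑' m : Fin d → ℕ, A.piPhi S hS k m * ((∑ j, m j : ℕ) : ℝ≥0∞) ^ r ≠ ∞

/-- All polynomial moments of the law of `φ` are finite. -/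
def PhiMoments : Prop :=
  ∀ r : ℕ, ∑' k : ℕ, A.law (A.phiEq S hS k) * (k : ℝ≥0∞) ^ r ≠ ∞

/-- `T_ε^k = sup {n ≥ 1 : (1/n) log D_φ^k(X_*^{k+n-1}) < I_φ - ε}`. -/
noncomputable def T (ε : ℝ) (k : ℕ) (ω : A.Sample) : ℝ≥0∞ :=
  ⨆ (n : ℕ) (_ : 1 ≤ n ∧
    ENNReal.log (A.D S hS k (k + n - 1) ω) / ((n : ℝ) : EReal) <
      (A.info S : EReal) - (ε : EReal)), (n : ℝ≥0∞)

/-- The condition for the lower delay bound. -/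
def LowerCondition : Prop :=
  ∀ ε : ℝ, 0 < ε → ∀ k : ℕ, 1 ≤ k →
    Tendsto (fun N : ℕ => A.lawPhi S hS k
      {ω | ((1 + ε : ℝ) : EReal) * (A.info S : EReal) ≤
        (⨆ n ∈ Finset.Icc 1 N, ENNReal.log (A.D S hS k (k + n) ω)) / ((N : ℝ) : EReal)})
      atTop (𝓝 0)

/-- The condition `E T_ε^φ < ∞` for the upper delay bound. -/
def UpperCondition : Prop :=
  ∀ ε : ℝ, 0 < ε →
    ∑' k : ℕ, A.law (A.phiEq S hS k) * ∫⁻ ω, A.T S hS ε k ω ∂(A.lawPhi S hS k) < ∞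

/-- `γ_S^n[n] = P(φ ≤ n | X_*^n)`. -/
noncomputable def posterior (n : ℕ) : A.Sample → ℝ :=
  A.law⟦{ω | A.phi S hS ω ≤ n} | A.filtration n⟧

/-- `τ_S`, the first time `n ≥ 1` at which the posterior probability of `φ ≤ n` is at
least `1 - α`. -/
noncomputable def tau (α : ℝ) (ω : A.Sample) : ℕ∞ :=
  ⨅ (n : ℕ) (_ : 1 ≤ n ∧ 1 - α ≤ A.posterior S hS n ω), (n : ℕ∞)

/-- The class of the sequential detection rules with false alarm probability at most `α`. -/
def ruleClass (α : ℝ) : Set (A.Sample → ℕ∞) :=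
  {τ | IsStoppingTime A.filtration τ ∧
    A.law {ω | τ ω ≤ (A.phi S hS ω : ℕ∞)} ≤ ENNReal.ofReal α}

/-- The detection delay `E[τ - φ | τ ≥ φ]`. -/
noncomputable def delay (τ : A.Sample → ℕ∞) : ℝ≥0∞ :=
  ∫⁻ ω, ((τ ω - (A.phi S hS ω : ℕ∞) : ℕ∞) : ℝ≥0∞)
    ∂(cond A.law {ω | (A.phi S hS ω : ℕ∞) ≤ τ ω})

end Functional

/-- `q_φ`, defined by `1 - exp (-q_φ) = 1 - ∏_{j ∈ S} (1 - ρ_j)`. -/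
noncomputable def qPhi (ρ : Fin d → ℝ) (S : Finset (Fin d)) : ℝ :=
  -Real.log (∏ j ∈ S, (1 - ρ j))

/-- Optimal delay: as `α → 0`, the delay of `τ_S` and the least delay of the rules with false
alarm probability at most `α` are both equal to `|log α| / (q_φ + I_φ) * (1 + o(1))`. -/
def OptimalDelay (ρ : Fin d → ℝ) (S : Finset (Fin d)) (hS : S.Nonempty) : Prop :=
  Tendsto (fun α : ℝ => A.delay S hS (A.tau S hS α) /
      ENNReal.ofReal (|Real.log α| / (qPhi ρ S + (A.info S).toReal))) (𝓝[>] 0) (𝓝 1) ∧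
  Tendsto (fun α : ℝ => (⨅ τ ∈ A.ruleClass S hS α, A.delay S hS τ) /
      ENNReal.ofReal (|Real.log α| / (qPhi ρ S + (A.info S).toReal))) (𝓝[>] 0) (𝓝 1)

end Model

end ChangePoint

/-! The joint law is a countable mixture, over the values `m` of the change points, of laws `slice
m` under which the observations are independent. Conditioning on `φ = k` only reweights the mixture,
so almost sure statements and expectations can be treated one `m` at a time.

The tails in the concentration hypothesis are summable in `n`. By Borel–Cantelli, `log D` grows at
most at rate `I_φ + ε'` under `slice m`, hence so do its running maxima, and dominated convergence
gives the first claim (`tendsto_lawPhi_iSup_log_D`). For the second, the mean of `T` given `m` is at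
most a starting index of order `(p / ε')²` plus the sum of a convergent series that does not depend
on `m` (`lintegral_T_le`). It remains to average a polynomial over the prior; its mean is finite
because the moment hypotheses bound every moment of every single prior
(`tsum_prior_mul_pow_ne_top`).

For the third claim, geometric priors have no memory: the part of the law with `φ > n` is a copy of
the whole law with the change points in `S` delayed by `n`, times `exp (-q_φ n)`. Up to time `n`
such a delay looks like no change on `S`, so `P(φ > n)` times the likelihood given `φ > n` is `exp
(-q_φ n) * likInfty` (`tsum_weight_mul_likelihood`). Lower bound: a stop at time `k + n` with `D ≤
exp c` costs, after a change of measure from `φ = k` to `φ > k + n`, a false alarm of comparable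
probability up to the factor `exp (c + q_φ (k + n))`. With at most `α` to spend, stopping before `(1
- δ) |log α| / (q_φ + I_φ)` is improbable, and Markov's inequality bounds the mean delay. Upper
bound: the posterior odds of `φ ≤ n` are at least those of `φ = k` alone, which grow like `exp (ν
(q_φ + I_φ - δ))` in `ν = n - k + 1` as soon as `ν > T`. Hence `τ_S - φ` is at most `T` plus about
`|log α| / (q_φ + I_φ - δ)`, and `T` has finite mean. -/

/-! ### Finite products of measures with densities. -/

theorem lintegral_pi_fin_prod {n : ℕ} {E : Fin n → Type*} {mE : ∀ i, MeasurableSpace (E i)}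
    {μ : (i : Fin n) → Measure (E i)} [∀ i, SigmaFinite (μ i)] {f : (i : Fin n) → E i → ℝ≥0∞}
    (hf : ∀ i, Measurable (f i)) :
    ∫⁻ x, ∏ i, f i (x i) ∂(Measure.pi μ) = ∏ i, ∫⁻ x, f i x ∂(μ i) := by
  induction n with
  | zero => simp
  | succ n ih =>
    calc
      _ = ∫⁻ x : E 0 × ((i : Fin n) → E (Fin.succ i)),
            f 0 x.1 * ∏ i : Fin n, f (Fin.succ i) (x.2 i)
            ∂((μ 0).prod (Measure.pi (fun i ↦ μ i.succ))) := by
          rw [← ((measurePreserving_piFinSuccAbove μ 0).symm).lintegral_comp_emb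
            (MeasurableEquiv.measurableEmbedding _)]
          change ∫⁻ x : E 0 × ((i : Fin n) → E (Fin.succ i)),
              ∏ i, f i ((Fin.insertNthEquiv E 0) x i)
            ∂((μ 0).prod (Measure.pi (fun i ↦ μ i.succ))) = _
          refine lintegral_congr fun x => ?_
          rw [Fin.prod_univ_succ]
          rfl
      _ = (∫⁻ x, f 0 x ∂μ 0)
            * ∏ i : Fin n, ∫⁻ (x : E (Fin.succ i)), f (Fin.succ i) x ∂(μ i.succ) := by
          rw [← ih fun i => hf _, ← lintegral_prod_mul (hf 0).aemeasurable]
          exact (Finset.measurable_prod _ fun i _ =>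
            (hf i.succ).comp (measurable_pi_apply i)).aemeasurable
      _ = _ := by rw [Fin.prod_univ_succ]

theorem lintegral_pi_prod {ι : Type*} [Fintype ι] {E : ι → Type*} {mE : ∀ i, MeasurableSpace (E i)}
    {μ : (i : ι) → Measure (E i)} [∀ i, SigmaFinite (μ i)] {f : (i : ι) → E i → ℝ≥0∞}
    (hf : ∀ i, Measurable (f i)) :
    ∫⁻ x, ∏ i, f i (x i) ∂(Measure.pi μ) = ∏ i, ∫⁻ x, f i x ∂(μ i) := by
  let e := (Fintype.equivFin ι).symm
  rw [← (measurePreserving_piCongrLeft μ e).lintegral_comp_emb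
    (MeasurableEquiv.measurableEmbedding _)]
  simp_rw [← e.prod_comp, MeasurableEquiv.coe_piCongrLeft, Equiv.piCongrLeft_apply_apply]
  exact lintegral_pi_fin_prod fun i => hf _

theorem pi_withDensity {ι : Type*} [Fintype ι] {E : ι → Type*} {mE : ∀ i, MeasurableSpace (E i)}
    {μ : (i : ι) → Measure (E i)} [∀ i, SigmaFinite (μ i)] {f : (i : ι) → E i → ℝ≥0∞}
    (hf : ∀ i, Measurable (f i)) [∀ i, SigmaFinite ((μ i).withDensity (f i))] :
    Measure.pi (fun i => (μ i).withDensity (f i)) =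
      (Measure.pi μ).withDensity fun x => ∏ i, f i (x i) := by
  refine Measure.pi_eq fun s hs => ?_
  rw [withDensity_apply _ (MeasurableSet.univ_pi hs),
    ← lintegral_indicator (MeasurableSet.univ_pi hs)]
  have : ∀ x : (i : ι) → E i, (Set.univ.pi s).indicator (fun x => ∏ i, f i (x i)) x =
      ∏ i, (s i).indicator (f i) (x i) := by
    intro x
    by_cases hx : x ∈ Set.univ.pi s
    · rw [Set.indicator_of_mem hx]
      exact Finset.prod_congr rfl fun i _ => (Set.indicator_of_mem (hx i trivial) _).symm
    · rw [Set.indicator_of_notMem hx]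
      simp only [Set.mem_pi, Set.mem_univ, forall_const, not_forall] at hx
      obtain ⟨i, hi⟩ := hx
      exact (Finset.prod_eq_zero (Finset.mem_univ i) (Set.indicator_of_notMem hi _)).symm
  simp_rw [this]
  rw [lintegral_pi_prod fun i => (hf i).indicator (hs i)]
  refine Finset.prod_congr rfl fun i _ => ?_
  rw [lintegral_indicator (hs i), withDensity_apply _ (hs i)]

/-- The σ-algebra is left free so that the statement serves both the full σ-algebra and each
`filtration n`. -/
theorem measurable_tsum_const_mul {Ω ι : Type*} {_ : MeasurableSpace Ω} [Countable ι]
    (c : ι → ℝ≥0∞) {F : ι → Ω → ℝ≥0∞} (hF : ∀ i, Measurable (F i)) :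
    Measurable fun ω => ∑' i, c i * F i ω :=
  Measurable.tsum fun i => (hF i).const_mul (c i)

/-! ### The joint law and its conditional laws as mixtures. -/

namespace ChangePoint.Model

variable {d : ℕ} {𝓧 : Type*} [MeasurableSpace 𝓧] (A : Model d 𝓧)

/-- The prior probability of `λ_* = m`. -/
noncomputable def weight (m : Fin d → ℕ) : ℝ≥0∞ := ∏ j, A.prior j (m j)

/-- The law of the sample when the change points are equal to `m`. -/
noncomputable def slice (m : Fin d → ℕ) : Measure A.Sample :=
  (A.obsLaw fun j => (m j : ℕ∞)).map (Prod.mk m)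

theorem obsDensity_eq (m : Fin d → ℕ∞) (p : ExtEdge A.graph × ℕ) :
    A.obsDensity m p = A.g p.1 ∨ A.obsDensity m p = A.f p.1 := by
  unfold obsDensity
  split_ifs <;> simp

theorem measurable_obsDensity (m : Fin d → ℕ∞) (p : ExtEdge A.graph × ℕ) :
    Measurable (A.obsDensity m p) := by
  obtain h | h := A.obsDensity_eq m p <;> rw [h]
  exacts [A.measurable_g _, A.measurable_f _]

instance isProbabilityMeasure_withDensity (m : Fin d → ℕ∞) (p : ExtEdge A.graph × ℕ) :
    IsProbabilityMeasure (A.μ.withDensity fun x => (A.obsDensity m p x : ℝ≥0∞)) := by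
  constructor
  rw [withDensity_apply _ .univ, Measure.restrict_univ]
  obtain h | h := A.obsDensity_eq m p <;> rw [h]
  exacts [A.lintegral_g _, A.lintegral_f _]

instance (m : Fin d → ℕ∞) : IsProbabilityMeasure (A.obsLaw m) := by
  unfold obsLaw; infer_instance

instance (m : Fin d → ℕ) : IsProbabilityMeasure (A.slice m) :=
  Measure.isProbabilityMeasure_map measurable_prodMk_left.aemeasurable

theorem slice_apply (m : Fin d → ℕ) {B : Set A.Sample} (hB : MeasurableSet B) :
    A.slice m B = A.obsLaw (fun j => (m j : ℕ∞)) {x | (m, x) ∈ B} :=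
  Measure.map_apply measurable_prodMk_left hB

theorem law_eq : A.law = Measure.sum fun m => A.weight m • A.slice m := by
  simp only [law, Measure.dirac_prod, weight, slice]

theorem law_apply {B : Set A.Sample} (hB : MeasurableSet B) :
    A.law B = ∑' m, A.weight m * A.slice m B := by
  simp [law_eq, Measure.sum_apply _ hB]

theorem lintegral_law (F : A.Sample → ℝ≥0∞) :
    ∫⁻ ω, F ω ∂A.law = ∑' m, A.weight m * ∫⁻ ω, F ω ∂A.slice m := by
  simp [law_eq, lintegral_sum_measure]

/-- The prior of the vector of change points. -/
noncomputable def priorLaw : Measure (Fin d → ℕ) := Measure.pi fun j => (A.prior j).toMeasure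

theorem priorLaw_singleton (m : Fin d → ℕ) : A.priorLaw {m} = A.weight m := by
  simp [priorLaw, weight, PMF.toMeasure_apply_singleton]

theorem tsum_weight_mul (F : (Fin d → ℕ) → ℝ≥0∞) :
    ∑' m, A.weight m * F m = ∫⁻ m, F m ∂A.priorLaw := by
  rw [lintegral_countable']
  simp [priorLaw_singleton, mul_comm]

theorem tsum_weight : ∑' m, A.weight m = 1 := by
  have := A.tsum_weight_mul fun _ => 1
  simpa [priorLaw] using this

/-- The marginal priors. -/
theorem tsum_weight_coord (i : Fin d) (F : ℕ → ℝ≥0∞) :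
    ∑' m, A.weight m * F (m i) = ∑' a, A.prior i a * F a := by
  have h := (measurePreserving_eval (fun j => (A.prior j).toMeasure) i).lintegral_comp
    (Measurable.of_discrete (f := F))
  rw [A.tsum_weight_mul (fun m => F (m i)), priorLaw]
  refine h.trans ?_
  rw [lintegral_countable']
  simp [PMF.toMeasure_apply_singleton, mul_comm]

theorem weight_ne_top (m : Fin d → ℕ) : A.weight m ≠ ∞ :=
  ENNReal.prod_ne_top fun j _ => (A.prior j).apply_ne_top _

instance : IsProbabilityMeasure A.law := by
  constructor
  rw [A.law_apply .univ]
  simp [A.tsum_weight]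

theorem measurableSet_fst (P : (Fin d → ℕ) → Prop) : MeasurableSet {ω : A.Sample | P ω.1} :=
  measurable_fst (MeasurableSet.of_discrete (s := {m | P m}))

open Classical in
theorem slice_fst (P : (Fin d → ℕ) → Prop) (m : Fin d → ℕ) :
    A.slice m {ω | P ω.1} = if P m then 1 else 0 := by
  rw [A.slice_apply m (A.measurableSet_fst P)]
  split_ifs with h <;> simp [h]

theorem slice_inter_fst (P : (Fin d → ℕ) → Prop) [DecidablePred P] (m : Fin d → ℕ)
    {B : Set A.Sample} (hB : MeasurableSet B) :
    A.slice m (B ∩ {ω | P ω.1}) = if P m then A.slice m B else 0 := by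
  rw [A.slice_apply m (hB.inter (A.measurableSet_fst P)), A.slice_apply m hB]
  split_ifs with h <;> simp [h]

theorem law_inter_fst (P : (Fin d → ℕ) → Prop) [DecidablePred P]
    {B : Set A.Sample} (hB : MeasurableSet B) :
    A.law (B ∩ {ω | P ω.1}) = ∑' m, if P m then A.weight m * A.slice m B else 0 := by
  rw [A.law_apply (hB.inter (A.measurableSet_fst P))]
  refine tsum_congr fun m => ?_
  rw [A.slice_inter_fst P m hB]
  split_ifs <;> simp

theorem law_fst (P : (Fin d → ℕ) → Prop) [DecidablePred P] :
    A.law {ω | P ω.1} = ∑' m, if P m then A.weight m else 0 := by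
  have := A.law_inter_fst P .univ
  simpa using this

theorem law_lamEq (m : Fin d → ℕ) : A.law (A.lamEq m) = A.weight m := by
  rw [lamEq, A.law_fst (· = m)]
  simp

theorem measurableSet_lamEq (m : Fin d → ℕ) : MeasurableSet (A.lamEq m) :=
  A.measurableSet_fst (· = m)

theorem lawLam_eq_slice {m : Fin d → ℕ} (h : A.weight m ≠ 0) : A.lawLam m = A.slice m := by
  ext B hB
  rw [lawLam, cond_apply (A.measurableSet_lamEq m), law_lamEq, Set.inter_comm, lamEq,
    A.law_inter_fst (· = m) hB]
  simp [← mul_assoc, ENNReal.inv_mul_cancel h (A.weight_ne_top m)]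

section

variable (S : Finset (Fin d)) (hS : S.Nonempty)

theorem measurableSet_phiEq (k : ℕ) : MeasurableSet (A.phiEq S hS k) :=
  A.measurableSet_fst fun m => S.inf' hS m = k

theorem law_phiEq (k : ℕ) :
    A.law (A.phiEq S hS k) = ∑' m, if S.inf' hS m = k then A.weight m else 0 :=
  A.law_fst fun m => S.inf' hS m = k

theorem law_phiEq_mul_lawPhi (k : ℕ) {B : Set A.Sample} (hB : MeasurableSet B) :
    A.law (A.phiEq S hS k) * A.lawPhi S hS k B =
      ∑' m, if S.inf' hS m = k then A.weight m * A.slice m B else 0 := by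
  rw [lawPhi, mul_comm, cond_mul_eq_inter (A.measurableSet_phiEq S hS k), Set.inter_comm]
  exact A.law_inter_fst (fun m => S.inf' hS m = k) hB

theorem law_phiEq_mul_piPhi (k : ℕ) (m : Fin d → ℕ) :
    A.law (A.phiEq S hS k) * A.piPhi S hS k m = if S.inf' hS m = k then A.weight m else 0 := by
  rw [piPhi, law_phiEq_mul_lawPhi A S hS k (A.measurableSet_lamEq m), tsum_eq_single m]
  · simp [lamEq, A.slice_fst (· = m)]
  · intro m' h
    simp [lamEq, A.slice_fst (· = m), h]

theorem piPhi_eq (k : ℕ) (m : Fin d → ℕ) :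
    A.piPhi S hS k m =
      (A.law (A.phiEq S hS k))⁻¹ * if S.inf' hS m = k then A.weight m else 0 := by
  by_cases h : A.law (A.phiEq S hS k) = 0
  · have h' := A.law_phiEq_mul_piPhi S hS k m
    rw [h, zero_mul] at h'
    rw [← h', piPhi, lawPhi, cond_eq_zero_of_meas_eq_zero h]
    simp
  · rw [← law_phiEq_mul_piPhi, ← mul_assoc, ENNReal.inv_mul_cancel h (by finiteness), one_mul]

theorem piPhi_ne_zero {k : ℕ} {m : Fin d → ℕ} (h : A.piPhi S hS k m ≠ 0) :
    S.inf' hS m = k ∧ A.weight m ≠ 0 := by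
  rw [piPhi_eq] at h
  split_ifs at h with hk
  · exact ⟨hk, right_ne_zero_of_mul h⟩
  · simp at h

theorem piPhi_pos {m : Fin d → ℕ} (h : A.weight m ≠ 0) : 0 < A.piPhi S hS (S.inf' hS m) m := by
  rw [pos_iff_ne_zero]
  intro h'
  have := A.law_phiEq_mul_piPhi S hS (S.inf' hS m) m
  rw [h', mul_zero, if_pos rfl] at this
  exact h this.symm

/-- Equality fails when `φ = k` has probability zero, since `lawPhi` is then the zero measure. -/
theorem tsum_piPhi_le (k : ℕ) : ∑' m, A.piPhi S hS k m ≤ 1 := by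
  simp_rw [piPhi_eq, ENNReal.tsum_mul_left, ← A.law_phiEq S hS k]
  exact ENNReal.inv_mul_le_one _

theorem lawPhi_eq_sum (k : ℕ) :
    A.lawPhi S hS k = Measure.sum fun m => A.piPhi S hS k m • A.slice m := by
  ext B hB
  rw [Measure.sum_apply _ hB, lawPhi, cond_apply (A.measurableSet_phiEq S hS k), Set.inter_comm]
  have := A.law_inter_fst (fun m => S.inf' hS m = k) hB
  rw [show A.phiEq S hS k = {ω | S.inf' hS ω.1 = k} from rfl, this, ← ENNReal.tsum_mul_left]
  refine tsum_congr fun m => ?_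
  rw [Measure.smul_apply, piPhi_eq]
  split_ifs <;> simp [mul_assoc, phiEq, phi]

theorem lawPhi_apply (k : ℕ) {B : Set A.Sample} (hB : MeasurableSet B) :
    A.lawPhi S hS k B = ∑' m, A.piPhi S hS k m * A.slice m B := by
  simp [lawPhi_eq_sum, Measure.sum_apply _ hB]

theorem ae_lawPhi {k : ℕ} {P : A.Sample → Prop}
    (h : ∀ m, A.piPhi S hS k m ≠ 0 → ∀ᵐ ω ∂A.slice m, P ω) : ∀ᵐ ω ∂A.lawPhi S hS k, P ω := by
  rw [lawPhi_eq_sum, Measure.ae_sum_iff]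
  intro m
  by_cases hm : A.piPhi S hS k m = 0
  · simp [hm]
  · exact Measure.ae_smul_measure (h m hm) _

/-- Turns the average over `φ` of conditional means into an average over all change points, where
`φ` is a function of `m`. -/
theorem tsum_law_phiEq_mul_lintegral (F : ℕ → A.Sample → ℝ≥0∞) :
    ∑' k, A.law (A.phiEq S hS k) * ∫⁻ ω, F k ω ∂A.lawPhi S hS k =
      ∑' m, A.weight m * ∫⁻ ω, F (S.inf' hS m) ω ∂A.slice m := by
  simp_rw [lawPhi_eq_sum, lintegral_sum_measure, lintegral_smul_measure, ← ENNReal.tsum_mul_left,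
    smul_eq_mul, ← mul_assoc, law_phiEq_mul_piPhi]
  rw [ENNReal.tsum_comm]
  refine tsum_congr fun m => ?_
  rw [tsum_eq_single (S.inf' hS m)]
  · simp
  · intro k hk
    simp [hk.symm]

theorem tsum_law_phiEq : ∑' k, A.law (A.phiEq S hS k) = 1 := by
  simp_rw [law_phiEq]
  rw [ENNReal.tsum_comm, ← A.tsum_weight]
  exact tsum_congr fun m => by simp

theorem weight_ne_zero_pos {m : Fin d → ℕ} (h : A.weight m ≠ 0) (j : Fin d) : 1 ≤ m j := by
  by_contra hj
  apply h
  apply Finset.prod_eq_zero (Finset.mem_univ j)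
  rw [Nat.lt_one_iff.1 (not_le.1 hj), A.prior_zero]

/-! ### Measurability and finiteness of the likelihoods -/

theorem measurable_likelihood (n : ℕ) (m : Fin d → ℕ∞) : Measurable (A.likelihood n m) :=
  Finset.measurable_prod _ fun e _ => Finset.measurable_prod _ fun t _ =>
    ((A.measurable_obsDensity m (e, t)).comp (measurable_pi_apply (e, t))).coe_nnreal_ennreal

theorem measurable_likPhi (k n : ℕ) : Measurable (A.likPhi S hS k n) :=
  measurable_tsum_const_mul _ fun _ => A.measurable_likelihood n _

theorem measurable_likInfty (n : ℕ) : Measurable (A.likInfty S n) :=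
  measurable_tsum_const_mul _ fun _ => A.measurable_likelihood n _

theorem measurable_D (k n : ℕ) : Measurable (A.D S hS k n) :=
  ((A.measurable_likPhi S hS k n).comp measurable_snd).div
    ((A.measurable_likInfty S n).comp measurable_snd)

/-- The bound does not involve the change points, so every mixture of likelihoods of total mass at
most one is finite at every path. -/
theorem likelihood_le (n : ℕ) (m : Fin d → ℕ∞) (x : A.Obs) :
    A.likelihood n m x ≤ ∏ e : ExtEdge A.graph, ∏ t ∈ Finset.range n,
      ((A.f e (x (e, t)) + A.g e (x (e, t)) : ℝ≥0) : ℝ≥0∞) := by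
  refine Finset.prod_le_prod' fun e _ => Finset.prod_le_prod' fun t _ => ?_
  obtain h | h := A.obsDensity_eq m (e, t) <;> rw [h] <;> norm_cast <;> simp

theorem tsum_mul_likelihood_ne_top {c : (Fin d → ℕ) → ℝ≥0∞} (hc : ∑' m, c m ≤ 1) (n : ℕ)
    (g : (Fin d → ℕ) → Fin d → ℕ∞) (x : A.Obs) :
    ∑' m, c m * A.likelihood n (g m) x ≠ ∞ := by
  refine ne_top_of_le_ne_top ?_
    (ENNReal.tsum_le_tsum fun m => mul_le_mul_right (A.likelihood_le n (g m) x) (c m))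
  rw [ENNReal.tsum_mul_right]
  exact ENNReal.mul_ne_top (ne_top_of_le_ne_top ENNReal.one_ne_top hc)
    (ENNReal.prod_ne_top fun e _ => ENNReal.prod_ne_top fun t _ => ENNReal.coe_ne_top)

theorem likPhi_ne_top (k n : ℕ) (x : A.Obs) : A.likPhi S hS k n x ≠ ∞ :=
  A.tsum_mul_likelihood_ne_top (A.tsum_piPhi_le S hS k) n _ x

theorem likInfty_ne_top (n : ℕ) (x : A.Obs) : A.likInfty S n x ≠ ∞ :=
  A.tsum_mul_likelihood_ne_top A.tsum_weight.le n _ x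

/-- A vanishing factor in a term of the mixture is still present at every later time. -/
theorem likInfty_eq_zero_mono {n n' : ℕ} (h : n ≤ n') {x : A.Obs} (h0 : A.likInfty S n x = 0) :
    A.likInfty S n' x = 0 := by
  rw [likInfty, ENNReal.tsum_eq_zero] at h0 ⊢
  intro m
  specialize h0 m
  rw [mul_eq_zero] at h0 ⊢
  refine h0.imp_right fun h1 => ?_
  simp only [likelihood, Finset.prod_eq_zero_iff] at h1 ⊢
  obtain ⟨e, he, t, ht, h1⟩ := h1
  exact ⟨e, he, t, Finset.mem_range.2 ((Finset.mem_range.1 ht).trans_le h), h1⟩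

/-- A density is almost surely nonzero under the law it defines, and there are countably many
factors. -/
theorem ae_likelihood_ne_zero (m : Fin d → ℕ) :
    ∀ᵐ ω ∂A.slice m, ∀ n, A.likelihood n (fun j => (m j : ℕ∞)) ω.2 ≠ 0 := by
  have h : ∀ᵐ x ∂A.obsLaw (fun j => (m j : ℕ∞)), ∀ p : ExtEdge A.graph × ℕ,
      A.obsDensity (fun j => (m j : ℕ∞)) p (x p) ≠ 0 := by
    rw [ae_all_iff]
    intro p
    have h1 : ∀ᵐ y ∂A.μ.withDensity fun x => (A.obsDensity (fun j => (m j : ℕ∞)) p x : ℝ≥0∞),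
        A.obsDensity (fun j => (m j : ℕ∞)) p y ≠ 0 := by
      rw [ae_withDensity_iff (A.measurable_obsDensity _ p).coe_nnreal_ennreal]
      exact Eventually.of_forall fun y hy => by simpa using hy
    exact (measurePreserving_eval_infinitePi (fun p => A.μ.withDensity fun x =>
      (A.obsDensity (fun j => (m j : ℕ∞)) p x : ℝ≥0∞)) p).quasiMeasurePreserving.ae h1
  have h2 : ∀ᵐ x ∂A.obsLaw (fun j => (m j : ℕ∞)), ∀ n,
      A.likelihood n (fun j => (m j : ℕ∞)) x ≠ 0 := by
    filter_upwards [h] with x hx n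
    simp only [likelihood, ne_eq, Finset.prod_eq_zero_iff, not_exists, not_and]
    intro e _ t _
    simpa using hx (e, t)
  have hmeas : MeasurableSet {ω : A.Sample |
      ∀ n, A.likelihood n (fun j => (m j : ℕ∞)) ω.2 ≠ 0} := by
    simp only [Set.ofPred_forall]
    exact MeasurableSet.iInter fun n => ((A.measurable_likelihood n _).comp measurable_snd)
      (measurableSet_singleton (0 : ℝ≥0∞)).compl
  exact (ae_map_iff measurable_prodMk_left.aemeasurable hmeas).2 h2

theorem likPhi_ne_zero {k n : ℕ} {m : Fin d → ℕ} {x : A.Obs} (h : A.piPhi S hS k m ≠ 0)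
    (hx : A.likelihood n (fun j => (m j : ℕ∞)) x ≠ 0) : A.likPhi S hS k n x ≠ 0 := by
  rw [likPhi, Ne, ENNReal.tsum_eq_zero]
  exact fun h0 => mul_ne_zero h hx (h0 m)

/-! ### Densities of the finite-dimensional marginals -/

/-- Restriction to the observations before time `n`. -/
noncomputable def past (n : ℕ) (x : A.Obs) :
    ((Finset.univ : Finset (ExtEdge A.graph)) ×ˢ Finset.range n) → 𝓧 :=
  Finset.restrict _ x

theorem measurable_past (n : ℕ) : Measurable (A.past n) := Finset.measurable_restrict _

theorem filtration_eq (n : ℕ) :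
    A.filtration n = MeasurableSpace.comap (fun ω : A.Sample => A.past n ω.2) inferInstance := by
  apply le_antisymm
  · refine iSup_le fun e => iSup_le fun t => iSup_le fun ht => ?_
    have : (fun ω : A.Sample => ω.2 (e, t)) =
        (fun y => y ⟨(e, t), by simpa using ht⟩) ∘ fun ω : A.Sample => A.past n ω.2 := rfl
    rw [this, ← MeasurableSpace.comap_comp]
    exact MeasurableSpace.comap_mono (measurable_pi_apply _).comap_le
  · refine measurable_iff_comap_le.1 (@measurable_pi_lambda _ _ _ (A.filtration n) _ _ ?_)
    rintro ⟨⟨e, t⟩, h⟩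
    refine measurable_iff_comap_le.2 ?_
    exact le_iSup_of_le e (le_iSup_of_le t (le_iSup_of_le (by simpa using h) le_rfl))

theorem measurable_filtration_coord {n t : ℕ} (ht : t < n) (e : ExtEdge A.graph) :
    Measurable[A.filtration n] fun ω : A.Sample => ω.2 (e, t) := by
  refine measurable_iff_comap_le.2 ?_
  exact le_iSup_of_le e (le_iSup_of_le t (le_iSup_of_le ht le_rfl))

theorem measurable_filtration_likelihood (n : ℕ) (m : Fin d → ℕ∞) :
    Measurable[A.filtration n] fun ω : A.Sample => A.likelihood n m ω.2 :=
  Finset.measurable_prod _ fun e _ => Finset.measurable_prod _ fun t ht =>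
    ((A.measurable_obsDensity m (e, t)).comp
      (A.measurable_filtration_coord (Finset.mem_range.1 ht) e)).coe_nnreal_ennreal

theorem measurable_filtration_likPhi (k n : ℕ) :
    Measurable[A.filtration n] fun ω : A.Sample => A.likPhi S hS k n ω.2 :=
  measurable_tsum_const_mul _ fun _ => A.measurable_filtration_likelihood n _

theorem measurable_filtration_likInfty (n : ℕ) :
    Measurable[A.filtration n] fun ω : A.Sample => A.likInfty S n ω.2 :=
  measurable_tsum_const_mul _ fun _ => A.measurable_filtration_likelihood n _

theorem measurable_filtration_D (k n : ℕ) :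
    Measurable[A.filtration n] (A.D S hS k n) :=
  (A.measurable_filtration_likPhi S hS k n).div (A.measurable_filtration_likInfty S n)

/-- On events depending on the observations before time `n`, all conditional laws of the
observations have their likelihoods as densities with respect to a common measure. -/
theorem exists_reference (n : ℕ) : ∃ ν : Measure A.Obs, ∀ B : Set A.Sample,
    MeasurableSet[A.filtration n] B → ∃ B' : Set A.Obs, MeasurableSet B' ∧ B = Prod.snd ⁻¹' B' ∧
      ∀ m, A.obsLaw m B' = ∫⁻ x in B', A.likelihood n m x ∂ν := by
  classical
  have := A.sigmaFinite
  cases isEmpty_or_nonempty A.Obs with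
  | inl h0 =>
    refine ⟨0, fun B hB => ?_⟩
    have : IsEmpty A.Sample := Prod.isEmpty_right
    exact ⟨∅, .empty, Subsingleton.elim _ _, fun m => by simp⟩
  | inr h0 =>
    obtain ⟨x₀⟩ := h0
    let I := (Finset.univ : Finset (ExtEdge A.graph)) ×ˢ Finset.range n
    -- Since `μ` is only σ-finite, no infinite product of copies of it is used: the finite product
    -- over the first `n` times is pushed forward by completing each path with the fixed path `x₀`.
    let extend : (I → 𝓧) → A.Obs := fun y p => if h : p ∈ I then y ⟨p, h⟩ else x₀ p
    have hext : Measurable extend := by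
      rw [measurable_pi_iff]
      intro p
      by_cases h : p ∈ I
      · simpa [extend, h] using measurable_pi_apply _
      · simp [extend, h]
    have hpast : ∀ y, A.past n (extend y) = y := by
      intro y
      funext p
      exact dif_pos p.2
    refine ⟨(Measure.pi fun _ : I => A.μ).map extend, fun B hB => ?_⟩
    rw [filtration_eq] at hB
    obtain ⟨C, hC, rfl⟩ := hB
    refine ⟨A.past n ⁻¹' C, A.measurable_past n hC, rfl, fun m => ?_⟩
    rw [← Measure.map_apply (A.measurable_past n) hC, obsLaw]
    have h1 := Measure.infinitePi_map_restrict (I := I)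
      (fun p => A.μ.withDensity fun x => (A.obsDensity m p x : ℝ≥0∞))
    have h2 := pi_withDensity (ι := I) (μ := fun _ => A.μ)
      (f := fun p x => (A.obsDensity m p x : ℝ≥0∞))
      fun p => (A.measurable_obsDensity m p).coe_nnreal_ennreal
    refine (congrArg (fun ν : Measure (I → 𝓧) => ν C) (h1.trans h2)).trans ?_
    rw [setLIntegral_map (A.measurable_past n hC) (A.measurable_likelihood n m) hext,
      withDensity_apply _ hC, ← Set.preimage_comp]
    have : A.past n ∘ extend = id := funext hpast
    rw [this, Set.preimage_id]
    refine lintegral_congr fun y => ?_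
    rw [likelihood, ← Finset.prod_product', ← Finset.prod_coe_sort I]
    refine Finset.prod_congr rfl fun p _ => ?_
    have : extend y (p.1.1, p.1.2) = y p := dif_pos p.2
    rw [this]

/-- An inequality between mixture likelihoods that holds on an event of the past gives the
corresponding inequality between mixture probabilities. -/
theorem tsum_obsLaw_le_of_likelihood_le {n : ℕ} {B : Set A.Sample}
    (hB : MeasurableSet[A.filtration n] B) {a b : (Fin d → ℕ) → ℝ≥0∞}
    {u v : (Fin d → ℕ) → Fin d → ℕ∞}
    (h : ∀ ω ∈ B, ∑' m, a m * A.likelihood n (u m) ω.2 ≤ ∑' m, b m * A.likelihood n (v m) ω.2) :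
    ∑' m, a m * A.obsLaw (u m) (Prod.snd '' B) ≤ ∑' m, b m * A.obsLaw (v m) (Prod.snd '' B) := by
  obtain ⟨ν, hν⟩ := A.exists_reference n
  obtain ⟨B', hB', rfl, h'⟩ := hν B hB
  rw [Set.image_preimage_eq _ Prod.snd_surjective]
  simp_rw [h']
  have key : ∀ (c : (Fin d → ℕ) → ℝ≥0∞) (w : (Fin d → ℕ) → Fin d → ℕ∞),
      ∑' m, c m * ∫⁻ x in B', A.likelihood n (w m) x ∂ν =
        ∫⁻ x in B', ∑' m, c m * A.likelihood n (w m) x ∂ν := by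
    intro c w
    rw [lintegral_tsum fun m => ((A.measurable_likelihood n _).const_mul _).aemeasurable]
    exact tsum_congr fun m => (lintegral_const_mul _ (A.measurable_likelihood n _)).symm
  rw [key, key]
  -- The event only constrains the observations, so any change points may be paired with `x`.
  exact setLIntegral_mono' hB' fun x hx => h (fun _ => 0, x) hx

theorem tsum_slice_le_of_likelihood_le {n : ℕ} {B : Set A.Sample}
    (hB : MeasurableSet[A.filtration n] B) {a b : (Fin d → ℕ) → ℝ≥0∞}
    (h : ∀ ω ∈ B, ∑' m, a m * A.likelihood n (fun j => (m j : ℕ∞)) ω.2 ≤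
      ∑' m, b m * A.likelihood n (fun j => (m j : ℕ∞)) ω.2) :
    ∑' m, a m * A.slice m B ≤ ∑' m, b m * A.slice m B := by
  have hB' := (A.filtration.le n) B hB
  have : ∀ m, A.slice m B = A.obsLaw (fun j => (m j : ℕ∞)) (Prod.snd '' B) := by
    intro m
    rw [A.slice_apply m hB']
    obtain ⟨ν, hν⟩ := A.exists_reference n
    obtain ⟨C, -, rfl, -⟩ := hν B hB
    rw [Set.image_preimage_eq _ Prod.snd_surjective]
    rfl
  simp_rw [this]
  exact A.tsum_obsLaw_le_of_likelihood_le hB h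

end
end ChangePoint.Model

/-! ### Polynomial moments of the change points. -/

theorem MvPolynomial.exists_abs_eval_le {σ : Type*} (p : MvPolynomial σ ℝ) :
    ∃ (C : ℝ) (r : ℕ), 0 ≤ C ∧ ∀ (x : σ → ℝ) (B : ℝ), 1 ≤ B → (∀ i, |x i| ≤ B) →
      |p.eval x| ≤ C * B ^ r := by
  induction p using MvPolynomial.induction_on with
  | C a => exact ⟨|a|, 0, abs_nonneg a, fun x B _ _ => by simp⟩
  | add p q hp hq =>
    obtain ⟨C₁, r₁, h₁, hp⟩ := hp
    obtain ⟨C₂, r₂, h₂, hq⟩ := hq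
    refine ⟨C₁ + C₂, max r₁ r₂, add_nonneg h₁ h₂, fun x B hB hx => ?_⟩
    rw [map_add, add_mul]
    refine (abs_add_le _ _).trans (add_le_add ((hp x B hB hx).trans ?_) ((hq x B hB hx).trans ?_))
    · exact mul_le_mul_of_nonneg_left (pow_le_pow_right₀ hB (le_max_left _ _)) h₁
    · exact mul_le_mul_of_nonneg_left (pow_le_pow_right₀ hB (le_max_right _ _)) h₂
  | mul_X p i hp =>
    obtain ⟨C, r, h, hp⟩ := hp
    refine ⟨C, r + 1, h, fun x B hB hx => ?_⟩
    rw [map_mul, MvPolynomial.eval_X, abs_mul, pow_succ, ← mul_assoc]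
    exact mul_le_mul (hp x B hB hx) (hx i) (abs_nonneg _) (by positivity)

theorem sum_pow_le_card_pow_mul {ι : Type*} [Fintype ι] [Nonempty ι] (m : ι → ℕ) (r : ℕ) :
    (∑ j, m j) ^ r ≤ Fintype.card ι ^ r * ∑ j, m j ^ r := by
  obtain ⟨i, -, hi⟩ := Finset.exists_max_image Finset.univ m Finset.univ_nonempty
  calc (∑ j, m j) ^ r ≤ (Fintype.card ι * m i) ^ r := by
        refine Nat.pow_le_pow_left ?_ r
        simpa using Finset.sum_le_card_nsmul Finset.univ m (m i) fun j _ => hi j (Finset.mem_univ j)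
    _ ≤ _ := by
        rw [mul_pow]
        exact Nat.mul_le_mul_left _
          (Finset.single_le_sum (f := fun j => m j ^ r) (fun _ _ => Nat.zero_le _)
            (Finset.mem_univ i))

namespace ChangePoint.Model

variable {d : ℕ} {𝓧 : Type*} [MeasurableSpace 𝓧] (A : Model d 𝓧)

variable (S : Finset (Fin d)) (hS : S.Nonempty)

/-- The hypothesis on `π_φ^k` is not uniform in `k`, so a single `k` is used. If `S` has an element
other than `i`, freeze all coordinates but the `i`-th at values `m₀` of positive probability, with
minimum `k` over `S \ {i}`. Then `φ = k` whenever `λ_i ≥ k`, so the tail of `π_i` is a multiple of a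
slice of `π_φ^k`. Otherwise `S = {i}` and `φ = λ_i`. -/
theorem tsum_prior_mul_pow_ne_top (hpi : A.PiPhiMoments S hS) (hphi : A.PhiMoments S hS)
    (i : Fin d) (r : ℕ) : ∑' a : ℕ, A.prior i a * (a : ℝ≥0∞) ^ r ≠ ∞ := by
  classical
  by_cases hS' : (S.erase i).Nonempty
  · choose m₀ hm₀ using fun j => (A.prior j).support_nonempty
    set k := (S.erase i).inf' hS' m₀ with hk
    set c := ∏ j ∈ Finset.univ.erase i, A.prior j (m₀ j) with hc
    have hc0 : c ≠ 0 := Finset.prod_ne_zero_iff.2 fun j _ => (PMF.mem_support_iff _ _).1 (hm₀ j)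
    have hct : c ≠ ∞ := ENNReal.prod_ne_top fun j _ => (A.prior j).apply_ne_top _
    have hw : ∀ a, A.weight (Function.update m₀ i a) = A.prior i a * c := by
      intro a
      rw [weight, ← Finset.mul_prod_erase Finset.univ _ (Finset.mem_univ i),
        Function.update_self, hc]
      congr 1
      refine Finset.prod_congr rfl fun j hj => ?_
      rw [Function.update_of_ne (Finset.ne_of_mem_erase hj)]
    have hphi_eq : ∀ a, k ≤ a → S.inf' hS (Function.update m₀ i a) = k := by
      intro a ha
      apply le_antisymm
      · obtain ⟨j, hj, hjk⟩ := Finset.exists_mem_eq_inf' hS' m₀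
        rw [hk, hjk]
        refine (Finset.inf'_le _ (Finset.mem_of_mem_erase hj)).trans ?_
        rw [Function.update_of_ne (Finset.ne_of_mem_erase hj)]
      · refine Finset.le_inf' _ _ fun j hj => ?_
        by_cases hji : j = i
        · subst hji
          simpa using ha
        · rw [Function.update_of_ne hji]
          exact Finset.inf'_le _ (Finset.mem_erase.2 ⟨hji, hj⟩)
    have hle : ∀ a : ℕ, A.prior i a * (a : ℝ≥0∞) ^ r ≤ A.prior i a * (k : ℝ≥0∞) ^ r +
        c⁻¹ * (A.law (A.phiEq S hS k) * (A.piPhi S hS k (Function.update m₀ i a) *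
          ((∑ j, Function.update m₀ i a j : ℕ) : ℝ≥0∞) ^ r)) := by
      intro a
      rcases le_total a k with ha | ha
      · refine le_add_right ?_
        gcongr
      · refine le_add_left ?_
        rw [← mul_assoc (A.law _), law_phiEq_mul_piPhi, if_pos (hphi_eq a ha), hw, mul_comm _ c,
          mul_assoc c, ← mul_assoc, ENNReal.inv_mul_cancel hc0 hct, one_mul]
        gcongr
        have := Finset.single_le_sum (f := Function.update m₀ i a) (fun _ _ => Nat.zero_le _)
          (Finset.mem_univ i)
        simpa using this
    refine ne_top_of_le_ne_top ?_ (ENNReal.tsum_le_tsum hle)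
    rw [ENNReal.tsum_add, ENNReal.tsum_mul_right, ENNReal.tsum_mul_left, ENNReal.tsum_mul_left,
      PMF.tsum_coe]
    refine ENNReal.add_ne_top.2 ⟨by finiteness, ENNReal.mul_ne_top (ENNReal.inv_ne_top.2 hc0)
      (ENNReal.mul_ne_top (by finiteness) ?_)⟩
    exact ne_top_of_le_ne_top (hpi k r)
      (ENNReal.tsum_comp_le_tsum_of_injective (Function.update_injective m₀ i) _)
  · have hSi : S = {i} := by
      rw [Finset.not_nonempty_iff_eq_empty, Finset.erase_eq_empty_iff] at hS'
      exact hS'.resolve_left hS.ne_empty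
    subst hSi
    have := hphi r
    simp only [law_phiEq, Finset.inf'_singleton] at this
    rw [← A.tsum_weight_coord i fun a => (a : ℝ≥0∞) ^ r]
    convert this using 1
    simp_rw [← ENNReal.tsum_mul_right]
    rw [ENNReal.tsum_comm]
    refine tsum_congr fun m => ?_
    rw [tsum_eq_single (m i)]
    · simp
    · intro k hk
      simp [hk.symm]

theorem tsum_weight_mul_sum_pow_ne_top (hpi : A.PiPhiMoments S hS) (hphi : A.PhiMoments S hS)
    (r : ℕ) : ∑' m, A.weight m * ((∑ j, m j : ℕ) : ℝ≥0∞) ^ r ≠ ∞ := by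
  have hle : ∀ m : Fin d → ℕ, A.weight m * ((∑ j, m j : ℕ) : ℝ≥0∞) ^ r ≤
      (d : ℝ≥0∞) ^ r * ∑ j, A.weight m * (m j : ℝ≥0∞) ^ r := by
    intro m
    rw [← Finset.mul_sum, mul_left_comm]
    gcongr
    have : Nonempty (Fin d) := ⟨hS.choose⟩
    have := sum_pow_le_card_pow_mul m r
    rw [Fintype.card_fin] at this
    exact_mod_cast this
  refine ne_top_of_le_ne_top ?_ (ENNReal.tsum_le_tsum hle)
  rw [ENNReal.tsum_mul_left, Summable.tsum_finsetSum fun _ _ => ENNReal.summable]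
  refine ENNReal.mul_ne_top (by finiteness) (ENNReal.sum_ne_top.2 fun j _ => ?_)
  rw [A.tsum_weight_coord j fun a => (a : ℝ≥0∞) ^ r]
  exact A.tsum_prior_mul_pow_ne_top S hS hpi hphi j r

theorem one_le_inf' {m : Fin d → ℕ} (h : A.weight m ≠ 0) : 1 ≤ S.inf' hS m :=
  Finset.le_inf' _ _ fun j _ => A.weight_ne_zero_pos h j

theorem inf'_le_sum (m : Fin d → ℕ) : S.inf' hS m ≤ ∑ j, m j := by
  obtain ⟨j, hj⟩ := hS
  exact (Finset.inf'_le m hj).trans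
    (Finset.single_le_sum (fun _ _ => Nat.zero_le _) (Finset.mem_univ j))

/-- A polynomial in the change points and in `φ` has a finite expectation. -/
theorem tsum_weight_mul_eval_ne_top (hpi : A.PiPhiMoments S hS) (hphi : A.PhiMoments S hS)
    (p : MvPolynomial (Option (Fin d)) ℝ) :
    ∑' m, A.weight m * ENNReal.ofReal
      |p.eval (fun o => o.elim ((S.inf' hS m : ℕ) : ℝ) (fun j => (m j : ℝ)))| ≠ ∞ := by
  obtain ⟨C, r, hC, hp⟩ := p.exists_abs_eval_le
  have hle : ∀ m, A.weight m * ENNReal.ofReal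
      |p.eval (fun o => o.elim ((S.inf' hS m : ℕ) : ℝ) (fun j => (m j : ℝ)))| ≤
      ENNReal.ofReal C * (A.weight m * ((∑ j, m j : ℕ) : ℝ≥0∞) ^ r) := by
    intro m
    by_cases hm : A.weight m = 0
    · simp [hm]
    rw [mul_left_comm]
    gcongr
    have h1 : 1 ≤ ((∑ j, m j : ℕ) : ℝ) := by
      exact_mod_cast (A.one_le_inf' S hS hm).trans (inf'_le_sum S hS m)
    refine (ENNReal.ofReal_le_ofReal (hp _ _ h1 ?_)).trans_eq ?_
    · rintro (_ | j)
      · simp only [Option.elim, Nat.abs_cast]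
        exact_mod_cast inf'_le_sum S hS m
      · simp only [Option.elim, Nat.abs_cast]
        exact_mod_cast Finset.single_le_sum (fun _ _ => Nat.zero_le _) (Finset.mem_univ j)
    · rw [ENNReal.ofReal_mul hC, ENNReal.ofReal_pow (by positivity), ENNReal.ofReal_natCast]
  refine ne_top_of_le_ne_top ?_ (ENNReal.tsum_le_tsum hle)
  rw [ENNReal.tsum_mul_left]
  exact ENNReal.mul_ne_top (by finiteness) (A.tsum_weight_mul_sum_pow_ne_top S hS hpi hphi r)

end ChangePoint.Model

/-! ### Consequences of concentration and the mean of `T`. -/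

theorem Polynomial.summable_eval_mul_exp_neg (q : Polynomial ℝ) {a : ℝ} (ha : 0 < a) :
    Summable fun n : ℕ => q.eval (n : ℝ) * Real.exp (-a * n) := by
  induction q using Polynomial.induction_on' with
  | add p q hp hq => simpa [add_mul] using hp.add hq
  | monomial r c => simpa [mul_assoc] using (Real.summable_pow_mul_exp_neg_nat_mul r ha).mul_left c

theorem EReal.ofReal_lt_abs_sub_iff {x : EReal} {I ε : ℝ} (hε : 0 ≤ ε) :
    ENNReal.ofReal ε < (x - (I : EReal)).abs ↔
      x < ((I - ε : ℝ) : EReal) ∨ ((I + ε : ℝ) : EReal) < x := by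
  induction x with
  | bot => simpa using EReal.bot_lt_coe (I - ε)
  | top => simpa using EReal.coe_lt_top (I + ε)
  | coe x =>
    rw [← EReal.coe_sub, EReal.abs_def, EReal.coe_lt_coe_iff, EReal.coe_lt_coe_iff,
      ENNReal.ofReal_lt_ofReal_iff_of_nonneg hε, lt_abs]
    constructor <;> rintro (h | h)
    · right; linarith
    · left; linarith
    · right; linarith
    · left; linarith

namespace ChangePoint.Model

variable {d : ℕ} {𝓧 : Type*} [MeasurableSpace 𝓧] (A : Model d 𝓧)

variable (S : Finset (Fin d)) (hS : S.Nonempty)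

/-- The concentration of `(1/n) log D_φ^{k,n}` around `I_φ`, at a Gaussian rate. -/
def Concentrated (ε₀ c₁ : ℝ) (p : MvPolynomial (Option (Fin d)) ℝ) (q : Polynomial ℝ) : Prop :=
  ∀ (k : ℕ) (m : Fin d → ℕ), 0 < A.piPhi S hS k m →
    ∀ n : ℕ, 1 ≤ n → ∀ ε : ℝ, 0 < ε → ε < ε₀ →
    1 / ε * p.eval (fun o => o.elim (k : ℝ) (fun j => (m j : ℝ))) ≤ √(n : ℝ) →
    A.lawLam m {ω | ENNReal.ofReal ε <
        (ENNReal.log (A.D S hS k n ω) / ((n : ℝ) : EReal) - (A.info S : EReal)).abs} ≤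
      ENNReal.ofReal (q.eval (n : ℝ) * Real.exp (-c₁ * n * ε ^ 2))

variable {A S hS} {ε₀ c₁ : ℝ} {p : MvPolynomial (Option (Fin d)) ℝ} {q : Polynomial ℝ}

theorem exists_weight_ne_zero : ∃ m, A.weight m ≠ 0 := by
  by_contra! h
  simpa [h] using A.tsum_weight

/-- If `I_φ` were infinite, the deviation event would be everything, yet its probability is bounded
by a quantity tending to zero. -/
theorem Concentrated.info_ne_top (hconc : A.Concentrated S hS ε₀ c₁ p q) (hε₀ : 0 < ε₀)
    (hc₁ : 0 < c₁) : A.info S ≠ ∞ := by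
  intro htop
  obtain ⟨m, hm⟩ := A.exists_weight_ne_zero
  set ε := ε₀ / 2 with hε
  set x := p.eval (fun o => o.elim ((S.inf' hS m : ℕ) : ℝ) (fun j => (m j : ℝ)))
  have h1 : ∀ᶠ n : ℕ in atTop, (1 : ℝ≥0∞) ≤
      ENNReal.ofReal (q.eval (n : ℝ) * Real.exp (-(c₁ * ε ^ 2) * n)) := by
    have hsqrt : ∀ᶠ n : ℕ in atTop, 1 / ε * x ≤ √(n : ℝ) :=
      (Real.tendsto_sqrt_atTop.comp tendsto_natCast_atTop_atTop).eventually_ge_atTop _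
    filter_upwards [hsqrt, eventually_ge_atTop 1] with n hn hn1
    have := hconc _ m (A.piPhi_pos S hS hm) n hn1 ε (by positivity) (by linarith) hn
    rw [lawLam_eq_slice A hm] at this
    convert this using 1
    -- In `EReal`, `x - ⊤ = ⊥` for every `x`, even `x = ⊤`, and `⊥` has infinite absolute value.
    · rw [htop, ← measure_univ (μ := A.slice m)]
      congr 1
      ext ω
      simp
    · congr 3; ring
  have h2 := ENNReal.tendsto_ofReal
    ((q.summable_eval_mul_exp_neg (a := c₁ * ε ^ 2) (by positivity)).tendsto_atTop_zero)
  rw [ENNReal.ofReal_zero] at h2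
  obtain ⟨n, hn, hn'⟩ := (h1.and (h2.eventually_lt_const zero_lt_one)).exists
  exact absurd hn hn'.not_ge

theorem Concentrated.slice_le (hconc : A.Concentrated S hS ε₀ c₁ p q) (hinfo : A.info S ≠ ∞)
    {m : Fin d → ℕ} (hm : A.weight m ≠ 0) {n : ℕ} (hn : 1 ≤ n) {ε : ℝ} (hε : 0 < ε) (hε' : ε < ε₀)
    (hp : 1 / ε * p.eval (fun o => o.elim ((S.inf' hS m : ℕ) : ℝ) (fun j => (m j : ℝ))) ≤
      √(n : ℝ)) :
    A.slice m {ω | ENNReal.log (A.D S hS (S.inf' hS m) n ω) <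
        ((n * ((A.info S).toReal - ε) : ℝ) : EReal) ∨
      ((n * ((A.info S).toReal + ε) : ℝ) : EReal) < ENNReal.log (A.D S hS (S.inf' hS m) n ω)} ≤
      ENNReal.ofReal (q.eval (n : ℝ) * Real.exp (-(c₁ * ε ^ 2) * n)) := by
  have := hconc _ m (A.piPhi_pos S hS hm) n hn ε hε hε' hp
  rw [lawLam_eq_slice A hm] at this
  convert this using 1
  · congr 1
    ext ω
    have hn0 : (0 : EReal) < ((n : ℝ) : EReal) := by exact_mod_cast hn
    rw [Set.mem_ofPred_eq, Set.mem_ofPred_eq, ← EReal.coe_ennreal_toReal hinfo,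
      EReal.ofReal_lt_abs_sub_iff hε.le,
      EReal.div_lt_iff hn0 (EReal.coe_ne_top _), EReal.lt_div_iff hn0 (EReal.coe_ne_top _),
      ← EReal.coe_mul, ← EReal.coe_mul, mul_comm (n : ℝ), mul_comm (n : ℝ)]
  · congr 3; ring

theorem measurable_log_D (k n : ℕ) : Measurable fun ω => ENNReal.log (A.D S hS k n ω) :=
  (A.measurable_D S hS k n).ennreal_log

/-- `T` is at most `R` plus the sum of all bad indices beyond `R`, and `R` is chosen so that
concentration applies beyond it. The series on the right depends on neither `m` nor `k`. -/
theorem Concentrated.lintegral_T_le (hconc : A.Concentrated S hS ε₀ c₁ p q)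
    (hinfo : A.info S ≠ ∞) {m : Fin d → ℕ} (hm : A.weight m ≠ 0) {ε ε' : ℝ} (hε : 0 < ε')
    (hε₀ : ε' < ε₀) (hle : ε' ≤ ε) (hI : ε' ≤ (A.info S).toReal) {R : ℕ}
    (hR : 1 / ε' * p.eval (fun o => o.elim ((S.inf' hS m : ℕ) : ℝ) (fun j => (m j : ℝ))) ≤
      √(R : ℝ)) :
    ∫⁻ ω, A.T S hS ε (S.inf' hS m) ω ∂A.slice m ≤ R + ∑' n : ℕ,
      (n : ℝ≥0∞) * ENNReal.ofReal (q.eval (n : ℝ) * Real.exp (-(c₁ * ε' ^ 2) * n)) := by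
  set k := S.inf' hS m with hk
  have hk1 : 1 ≤ k := A.one_le_inf' S hS hm
  set I := (A.info S).toReal with hI_def
  let E : ℕ → Set A.Sample := fun n => {ω | R < n ∧
    ENNReal.log (A.D S hS k (k + n - 1) ω) < ((((k + n - 1 : ℕ) : ℝ) * (I - ε') : ℝ) : EReal)}
  have hE : ∀ n, MeasurableSet (E n) := fun n =>
    (MeasurableSet.const (R < n)).inter
      (measurableSet_lt (measurable_log_D k (k + n - 1)) measurable_const)
  have hT : ∀ ω, A.T S hS ε k ω ≤ R + ∑' n : ℕ, (E n).indicator (fun _ => (n : ℝ≥0∞)) ω := by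
    intro ω
    refine iSup₂_le fun n hn => ?_
    rcases le_or_gt n R with hnR | hnR
    · exact le_add_right (by exact_mod_cast hnR)
    · refine le_add_left (le_trans ?_ (ENNReal.le_tsum n))
      rw [Set.indicator_of_mem]
      refine ⟨hnR, ?_⟩
      have hn0 : (0 : EReal) < ((n : ℝ) : EReal) := by exact_mod_cast hn.1
      have h := hn.2
      rw [← EReal.coe_ennreal_toReal hinfo, ← EReal.coe_sub,
        EReal.div_lt_iff hn0 (EReal.coe_ne_top _), ← EReal.coe_mul] at h
      refine h.trans_le (EReal.coe_le_coe_iff.2 ?_)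
      -- `T` divides by `n` a log-likelihood ratio taken at time `k + n - 1`. Because `ε' ≤ I`,
      -- replacing the divisor by that larger time keeps the event a downward deviation.
      have h1 : (n : ℝ) ≤ ((k + n - 1 : ℕ) : ℝ) := by exact_mod_cast (by omega)
      calc (I - ε) * n ≤ (I - ε') * n := by gcongr
        _ ≤ (I - ε') * ((k + n - 1 : ℕ) : ℝ) := by
            refine mul_le_mul_of_nonneg_left h1 (by linarith)
        _ = _ := mul_comm _ _
  calc ∫⁻ ω, A.T S hS ε k ω ∂A.slice m
      ≤ ∫⁻ ω, (R + ∑' n : ℕ, (E n).indicator (fun _ => (n : ℝ≥0∞)) ω) ∂A.slice m :=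
        lintegral_mono hT
    _ = R + ∑' n : ℕ, (n : ℝ≥0∞) * A.slice m (E n) := by
        rw [lintegral_add_left measurable_const,
          lintegral_tsum fun n => (measurable_const.indicator (hE n)).aemeasurable]
        simp [lintegral_indicator_const (hE _)]
    _ ≤ R + ∑' n : ℕ, ((k + n - 1 : ℕ) : ℝ≥0∞) * ENNReal.ofReal
          (q.eval ((k + n - 1 : ℕ) : ℝ) * Real.exp (-(c₁ * ε' ^ 2) * (k + n - 1 : ℕ))) := by
        gcongr with n
        · omega
        · by_cases hnR : R < n
          · refine (measure_mono fun ω hω => Or.inl hω.2).trans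
              (hconc.slice_le hinfo hm (n := k + n - 1) (by omega) hε hε₀ (hR.trans ?_))
            exact Real.sqrt_le_sqrt (by exact_mod_cast (by omega))
          · have : E n = ∅ := by
              ext ω
              simp [E, hnR]
            simp [this]
    _ ≤ _ := by
        refine add_le_add le_rfl ?_
        -- The terms are indexed by the distinct times `k + n - 1`, so a sum over all times bounds
        -- them uniformly in `k`.
        exact ENNReal.tsum_comp_le_tsum_of_injective (f := fun n : ℕ => k + n - 1)
          (fun a b hab => by simp only at hab; omega) fun n : ℕ => (n : ℝ≥0∞) *
            ENNReal.ofReal (q.eval (n : ℝ) * Real.exp (-(c₁ * ε' ^ 2) * n))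

theorem Concentrated.upperCondition (hconc : A.Concentrated S hS ε₀ c₁ p q) (hε₀ : 0 < ε₀)
    (hc₁ : 0 < c₁) (hinfo : 0 < A.info S)
    (hpi : A.PiPhiMoments S hS) (hphi : A.PhiMoments S hS) : A.UpperCondition S hS := by
  intro ε hε
  have hfin := hconc.info_ne_top hε₀ hc₁
  have hI : 0 < (A.info S).toReal := ENNReal.toReal_pos hinfo.ne' hfin
  set ε' := min (ε₀ / 2) (min ε (A.info S).toReal) with hε'_def
  have hε' : 0 < ε' := lt_min (by linarith) (lt_min hε hI)
  have hε₀' : ε' < ε₀ := (min_le_left _ _).trans_lt (by linarith)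
  have hle : ε' ≤ ε := (min_le_right _ _).trans (min_le_left _ _)
  have hI' : ε' ≤ (A.info S).toReal := (min_le_right _ _).trans (min_le_right _ _)
  let v : (Fin d → ℕ) → Option (Fin d) → ℝ :=
    fun m o => o.elim ((S.inf' hS m : ℕ) : ℝ) (fun j => (m j : ℝ))
  set K := ∑' n : ℕ,
    (n : ℝ≥0∞) * ENNReal.ofReal (q.eval (n : ℝ) * Real.exp (-(c₁ * ε' ^ 2) * n)) with hK_def
  have hK : K ≠ ∞ := by
    have hs := (Polynomial.X * q).summable_eval_mul_exp_neg (a := c₁ * ε' ^ 2) (by positivity)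
    have := hs.tsum_ofReal_ne_top
    convert this using 3 with n
    rw [Polynomial.eval_mul, Polynomial.eval_X, mul_assoc,
      ENNReal.ofReal_mul (p := (n : ℝ)) n.cast_nonneg,
      ENNReal.ofReal_natCast]
  rw [tsum_law_phiEq_mul_lintegral, lt_top_iff_ne_top]
  have key : ∀ m, A.weight m * ∫⁻ ω, A.T S hS ε (S.inf' hS m) ω ∂A.slice m ≤
      A.weight m * ENNReal.ofReal |((MvPolynomial.C (1 / ε') * p) ^ 2).eval (v m)| +
        A.weight m * (1 + K) := by
    intro m
    by_cases hm : A.weight m = 0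
    · simp [hm]
    rw [← mul_add, ← add_assoc]
    gcongr
    set y := 1 / ε' * p.eval (v m) with hy
    -- The index `R = ⌈y²⌉` is polynomial in the change points up to rounding, so it has finite
    -- mean.
    have hR : y ≤ √(⌈y ^ 2⌉₊ : ℝ) := by
      refine (le_abs_self y).trans ?_
      rw [← Real.sqrt_sq_eq_abs]
      exact Real.sqrt_le_sqrt (Nat.le_ceil _)
    refine (hconc.lintegral_T_le hfin hm hε' hε₀' hle hI' hR).trans ?_
    gcongr
    rw [map_pow, map_mul, MvPolynomial.eval_C, ← hy, abs_of_nonneg (sq_nonneg y),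
      ← ENNReal.ofReal_one, ← ENNReal.ofReal_add (sq_nonneg y) zero_le_one,
      ← ENNReal.ofReal_natCast]
    exact ENNReal.ofReal_le_ofReal (Nat.ceil_lt_add_one (sq_nonneg y)).le
  refine ne_top_of_le_ne_top ?_ (ENNReal.tsum_le_tsum key)
  rw [ENNReal.tsum_add, ENNReal.tsum_mul_right, A.tsum_weight]
  exact ENNReal.add_ne_top.2 ⟨A.tsum_weight_mul_eval_ne_top S hS hpi hphi _, by finiteness⟩

end ChangePoint.Model

/-! ### Running maxima of the log-likelihood ratio. -/

/-- A sequence without the value `∞` and of linear growth at most `a` has running maxima of linear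
growth less than `b`, for every `b > a`. -/
theorem EReal.eventually_iSup_lt {x : ℕ → EReal} (hx : ∀ n, x n ≠ ⊤) {a b : ℝ} (ha : 0 ≤ a)
    (hab : a < b) (h : ∀ᶠ n : ℕ in atTop, x n ≤ ((n * a : ℝ) : EReal)) (k : ℕ) :
    ∀ᶠ N : ℕ in atTop, ⨆ n ∈ Finset.Icc 1 N, x (k + n) < ((N * b : ℝ) : EReal) := by
  obtain ⟨n₀, hn₀⟩ := eventually_atTop.1 h
  -- The initial terms are dominated by one constant; a term equal to `⊥` counts as `0`, which is
  -- still an upper bound.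
  set C := ∑ n ∈ Finset.range n₀, |(x n).toReal| with hC
  have hxC : ∀ n, x n ≤ ((C + n * a : ℝ) : EReal) := by
    intro n
    rcases lt_or_ge n n₀ with hn | hn
    · refine (EReal.le_coe_toReal (hx n)).trans (EReal.coe_le_coe_iff.2 ?_)
      have h1 : |(x n).toReal| ≤ C :=
        Finset.single_le_sum (f := fun n => |(x n).toReal|) (fun _ _ => abs_nonneg _)
          (Finset.mem_range.2 hn)
      have h2 : 0 ≤ n * a := by positivity
      linarith [le_abs_self (x n).toReal]
    · refine (hn₀ n hn).trans (EReal.coe_le_coe_iff.2 ?_)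
      have : 0 ≤ C := Finset.sum_nonneg fun _ _ => abs_nonneg _
      linarith
  have hN : ∀ᶠ N : ℕ in atTop, (C + k * a) / (b - a) < N :=
    tendsto_natCast_atTop_atTop.eventually_gt_atTop _
  filter_upwards [hN] with N hN
  rw [div_lt_iff₀ (by linarith)] at hN
  refine lt_of_le_of_lt (b := ((C + (k + N : ℝ) * a : ℝ) : EReal)) ?_
    (EReal.coe_lt_coe_iff.2 (by linarith))
  refine iSup₂_le fun n hn => (hxC _).trans (EReal.coe_le_coe_iff.2 ?_)
  have : (n : ℝ) ≤ N := by exact_mod_cast (Finset.mem_Icc.1 hn).2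
  push_cast
  gcongr

namespace ChangePoint.Model

variable {d : ℕ} {𝓧 : Type*} [MeasurableSpace 𝓧] {A : Model d 𝓧}
  {S : Finset (Fin d)} {hS : S.Nonempty}
  {ε₀ c₁ : ℝ} {p : MvPolynomial (Option (Fin d)) ℝ} {q : Polynomial ℝ}

/-- Borel–Cantelli, applied to upward deviations from the index where the square-root condition
begins to hold. -/
theorem Concentrated.ae_eventually_log_D_le (hconc : A.Concentrated S hS ε₀ c₁ p q)
    (hc₁ : 0 < c₁) (hinfo : A.info S ≠ ∞) {m : Fin d → ℕ} (hm : A.weight m ≠ 0) {ε : ℝ}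
    (hε : 0 < ε) (hε' : ε < ε₀) :
    ∀ᵐ ω ∂A.slice m, ∀ᶠ n : ℕ in atTop, ENNReal.log (A.D S hS (S.inf' hS m) n ω) ≤
      ((n * ((A.info S).toReal + ε) : ℝ) : EReal) := by
  have hsqrt : ∀ᶠ n : ℕ in atTop, 1 / ε *
      p.eval (fun o => o.elim ((S.inf' hS m : ℕ) : ℝ) (fun j => (m j : ℝ))) ≤ √(n : ℝ) :=
    (Real.tendsto_sqrt_atTop.comp tendsto_natCast_atTop_atTop).eventually_ge_atTop _
  obtain ⟨n₀, hn₀⟩ := eventually_atTop.1 (hsqrt.and (eventually_ge_atTop 1))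
  have hbc := ae_eventually_notMem (μ := A.slice m)
    (s := fun n : ℕ => {ω | n₀ ≤ n ∧ ((n * ((A.info S).toReal + ε) : ℝ) : EReal) <
      ENNReal.log (A.D S hS (S.inf' hS m) n ω)}) <| by
    refine ne_top_of_le_ne_top ((q.summable_eval_mul_exp_neg
      (a := c₁ * ε ^ 2) (by positivity)).tsum_ofReal_ne_top) (ENNReal.tsum_le_tsum fun n => ?_)
    by_cases hn : n₀ ≤ n
    · exact (measure_mono fun ω hω => Or.inr hω.2).trans
        (hconc.slice_le hinfo hm (hn₀ n hn).2 hε hε' (hn₀ n hn).1)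
    · simp [hn]
  filter_upwards [hbc] with ω hω
  filter_upwards [hω, eventually_ge_atTop n₀] with n hn hn'
  by_contra h
  exact hn ⟨hn', not_le.1 h⟩

/-- Since `likPhi` is finite and nonzero, `D = ∞` means `likInfty = 0`, which persists for ever.
This excludes infinite early terms, which would spoil the running maxima. -/
theorem D_ne_top_of_eventually {k : ℕ} {ω : A.Sample} (hlik : ∀ n, A.likPhi S hS k n ω.2 ≠ 0)
    (h : ∀ᶠ n in atTop, A.D S hS k n ω ≠ ∞) (n : ℕ) : A.D S hS k n ω ≠ ∞ := by
  have htop : ∀ n, A.D S hS k n ω = ∞ ↔ A.likInfty S n ω.2 = 0 := by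
    intro n
    rw [D, ENNReal.div_eq_top]
    simp [hlik n, A.likPhi_ne_top S hS k n]
  intro hn
  obtain ⟨n', hn', hle⟩ := (h.and (eventually_ge_atTop n)).exists
  exact hn' ((htop n').2 (A.likInfty_eq_zero_mono S hle ((htop n).1 hn)))

/-- Almost surely the event fails for all large `N`, so its probability tends to zero by dominated
convergence. The factor `N` stands on the left to avoid division in `EReal`. -/
theorem Concentrated.tendsto_lawPhi_iSup_log_D (hconc : A.Concentrated S hS ε₀ c₁ p q)
    (hε₀ : 0 < ε₀) (hc₁ : 0 < c₁) (hinfo : 0 < A.info S) {ε : ℝ} (hε : 0 < ε) (k : ℕ) :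
    Tendsto (fun N : ℕ => A.lawPhi S hS k {ω | ((N * ((1 + ε) * (A.info S).toReal) : ℝ) : EReal) ≤
      ⨆ n ∈ Finset.Icc 1 N, ENNReal.log (A.D S hS k (k + n) ω)}) atTop (𝓝 0) := by
  have hfin := hconc.info_ne_top hε₀ hc₁
  have hI : 0 < (A.info S).toReal := ENNReal.toReal_pos hinfo.ne' hfin
  set I := (A.info S).toReal with hI_def
  set ε' := min (ε₀ / 2) (ε * I / 2) with hε'_def
  have hε' : 0 < ε' := lt_min (by linarith) (by positivity)
  have hε₀' : ε' < ε₀ := (min_le_left _ _).trans_lt (by linarith)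
  have hlt : I + ε' < (1 + ε) * I := by
    have : ε' ≤ ε * I / 2 := min_le_right _ _
    have : 0 < ε * I := by positivity
    linarith
  let B : ℕ → Set A.Sample := fun N => {ω | ((N * ((1 + ε) * I) : ℝ) : EReal) ≤
    ⨆ n ∈ Finset.Icc 1 N, ENNReal.log (A.D S hS k (k + n) ω)}
  have hB : ∀ N, MeasurableSet (B N) := fun N => measurableSet_le measurable_const
    (Measurable.iSup fun n => Measurable.iSup fun _ => measurable_log_D k (k + n))
  have hae : ∀ᵐ ω ∂A.lawPhi S hS k, ∀ᶠ N in atTop, ω ∈ B N ↔ ω ∈ (∅ : Set A.Sample) := by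
    refine A.ae_lawPhi S hS fun m hm => ?_
    obtain ⟨rfl, hw⟩ := A.piPhi_ne_zero S hS hm
    filter_upwards [hconc.ae_eventually_log_D_le hc₁ hfin hw hε' hε₀',
      A.ae_likelihood_ne_zero m] with ω hω hlik
    have htop : ∀ n, ENNReal.log (A.D S hS (S.inf' hS m) n ω) ≠ ⊤ := by
      intro n
      rw [Ne, ENNReal.log_eq_top_iff]
      refine D_ne_top_of_eventually (fun n => A.likPhi_ne_zero S hS hm (hlik n)) ?_ n
      filter_upwards [hω] with n hn h
      rw [h, ENNReal.log_top, top_le_iff] at hn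
      exact EReal.coe_ne_top _ hn
    filter_upwards [EReal.eventually_iSup_lt htop (by positivity) hlt hω (S.inf' hS m)] with N hN
    simpa [B] using hN
  have : IsFiniteMeasure (A.lawPhi S hS k) := by unfold lawPhi; infer_instance
  have hlim := tendsto_measure_of_ae_tendsto_indicator_of_isFiniteMeasure atTop .empty hB hae
  rwa [measure_empty] at hlim

theorem Concentrated.lowerCondition (hconc : A.Concentrated S hS ε₀ c₁ p q) (hε₀ : 0 < ε₀)
    (hc₁ : 0 < c₁) (hinfo : 0 < A.info S) : A.LowerCondition S hS := by
  intro ε hε k _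
  have hfin := hconc.info_ne_top hε₀ hc₁
  refine (hconc.tendsto_lawPhi_iSup_log_D hε₀ hc₁ hinfo hε k).congr' ?_
  filter_upwards [eventually_ge_atTop 1] with N hN
  congr 1
  ext ω
  have hN0 : (0 : EReal) < ((N : ℝ) : EReal) := by exact_mod_cast hN
  rw [Set.mem_ofPred_eq, Set.mem_ofPred_eq]
  rw [← EReal.coe_ennreal_toReal hfin, ← EReal.coe_mul,
    EReal.le_div_iff_mul_le hN0 (EReal.coe_ne_top _), ← EReal.coe_mul, mul_comm (N : ℝ)]

end ChangePoint.Model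

/-! ### Geometric priors: lack of memory and change of measure. -/

namespace ChangePoint.Model

variable {d : ℕ} {𝓧 : Type*} [MeasurableSpace 𝓧] (A : Model d 𝓧)
  (S : Finset (Fin d)) (hS : S.Nonempty) {ρ : Fin d → ℝ}

/-- Delay all the change points in `S` by `n`. -/
def shift (n : ℕ) (m : Fin d → ℕ) (j : Fin d) : ℕ := if j ∈ S then m j + n else m j

theorem shift_injective (n : ℕ) : Function.Injective (shift S n) := by
  intro m m' h
  funext j
  have := congrFun h j
  unfold shift at this
  split_ifs at this <;> omega

theorem inf'_shift (n : ℕ) (m : Fin d → ℕ) : S.inf' hS (shift S n m) = S.inf' hS m + n := by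
  rw [Finset.apply_inf'_eq_inf'_comp hS (· + n) fun a b => (min_add_add_right a b n).symm]
  exact Finset.inf'_congr hS rfl fun j hj => if_pos hj

theorem lt_edgeMin_iff (m : Fin d → ℕ∞) (e : ExtEdge A.graph) (c : ℕ∞) :
    c < A.edgeMin m e ↔ ∀ j ∈ e.1, c < m j := by
  obtain ⟨e, he⟩ := e
  induction e with
  | _ i j => simp [edgeMin]

theorem likelihood_congr {n : ℕ} {m m' : Fin d → ℕ∞}
    (h : ∀ j, ∀ t < n, ((t + 1 : ℕ) : ℕ∞) < m j ↔ ((t + 1 : ℕ) : ℕ∞) < m' j) (x : A.Obs) :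
    A.likelihood n m x = A.likelihood n m' x := by
  refine Finset.prod_congr rfl fun e _ => Finset.prod_congr rfl fun t ht => ?_
  have : A.obsDensity m (e, t) = A.obsDensity m' (e, t) := by
    unfold obsDensity
    congr 1
    simp only [lt_edgeMin_iff, eq_iff_iff]
    exact forall₂_congr fun j _ => h j t (Finset.mem_range.1 ht)
  rw [this]

theorem prod_one_sub_mem_Ioo (hS : S.Nonempty) (hρ : A.GeometricPriors ρ) :
    ∏ j ∈ S, (1 - ρ j) ∈ Set.Ioo (0 : ℝ) 1 := by
  refine ⟨Finset.prod_pos fun j _ => by linarith [(hρ j).1.2], ?_⟩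
  obtain ⟨i, hi⟩ := hS
  rw [← Finset.mul_prod_erase S _ hi]
  refine mul_lt_one_of_nonneg_of_lt_one_left (by linarith [(hρ i).1.2]) (by linarith [(hρ i).1.1])
    (Finset.prod_le_one (fun j _ => by linarith [(hρ j).1.2]) fun j _ => by linarith [(hρ j).1.1])

theorem qPhi_pos (hS : S.Nonempty) (hρ : A.GeometricPriors ρ) : 0 < qPhi ρ S := by
  have h := A.prod_one_sub_mem_Ioo S hS hρ
  exact neg_pos.2 (Real.log_neg h.1 h.2)

theorem exp_neg_qPhi (hρ : A.GeometricPriors ρ) :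
    Real.exp (-qPhi ρ S) = ∏ j ∈ S, (1 - ρ j) := by
  rw [qPhi, neg_neg, Real.exp_log (Finset.prod_pos fun j _ => by linarith [(hρ j).1.2])]

theorem weight_shift (hρ : A.GeometricPriors ρ) (n : ℕ) {m : Fin d → ℕ} (hm : ∀ j ∈ S, 1 ≤ m j) :
    A.weight (shift S n m) = ENNReal.ofReal (Real.exp (-qPhi ρ S * n)) * A.weight m := by
  have h1 : ENNReal.ofReal (Real.exp (-qPhi ρ S * n)) =
      ∏ j, if j ∈ S then ENNReal.ofReal ((1 - ρ j) ^ n) else 1 := by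
    rw [mul_comm, Real.exp_nat_mul, A.exp_neg_qPhi S hρ, ← Finset.prod_pow,
      ENNReal.ofReal_prod_of_nonneg fun j _ => pow_nonneg (by linarith [(hρ j).1.2]) n]
    simp
  rw [h1, weight, weight, ← Finset.prod_mul_distrib]
  refine Finset.prod_congr rfl fun j _ => ?_
  unfold shift
  split_ifs with hj
  · have := hm j hj
    rw [(hρ j).2 _ (by omega), (hρ j).2 _ this,
      ← ENNReal.ofReal_mul (pow_nonneg (by linarith [(hρ j).1.2]) n), ← mul_assoc, ← pow_add]
    congr 4
    omega
  · rw [one_mul]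

/-- The lack of memory of the geometric priors. -/
theorem tsum_weight_shift (hρ : A.GeometricPriors ρ) (n : ℕ) (F : (Fin d → ℕ) → ℝ≥0∞) :
    ∑' m, (if n < S.inf' hS m then A.weight m * F m else 0) =
      ENNReal.ofReal (Real.exp (-qPhi ρ S * n)) * ∑' m, A.weight m * F (shift S n m) := by
  rw [← (shift_injective S n).tsum_eq, ← ENNReal.tsum_mul_left]
  · refine tsum_congr fun m => ?_
    rw [inf'_shift]
    by_cases h : 0 < S.inf' hS m
    · rw [if_pos (by omega), A.weight_shift S hρ n fun j hj => h.trans_le (Finset.inf'_le m hj),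
        mul_assoc]
    · rw [if_neg (by omega)]
      have : A.weight m = 0 := by
        by_contra h'
        exact h (A.one_le_inf' S hS h')
      simp [this]
  · intro m hm
    have hm' : n < S.inf' hS m := by
      by_contra h
      exact hm (if_neg h)
    refine ⟨fun j => if j ∈ S then m j - n else m j, ?_⟩
    funext j
    by_cases hj : j ∈ S
    · have := hm'.trans_le (Finset.inf'_le m hj)
      simp only [shift, hj, if_true]
      omega
    · simp [shift, hj]

theorem law_phiEq_succ (hρ : A.GeometricPriors ρ) (n : ℕ) :
    A.law (A.phiEq S hS (n + 1)) =
      ENNReal.ofReal (Real.exp (-qPhi ρ S * n)) * A.law (A.phiEq S hS 1) := by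
  have := A.tsum_weight_shift S hS hρ n fun m => if S.inf' hS m = n + 1 then 1 else 0
  rw [law_phiEq, law_phiEq]
  convert this using 3 with m m
  · by_cases h : S.inf' hS m = n + 1 <;> simp [h]
  · funext m
    rw [inf'_shift, add_comm n 1]
    simp

theorem law_phiEq_zero : A.law (A.phiEq S hS 0) = 0 := by
  rw [law_phiEq, ENNReal.tsum_eq_zero]
  intro m
  split_ifs with h
  · by_contra h'
    have := A.one_le_inf' S hS h'
    omega
  · rfl

theorem law_phiEq_one_ne_zero (hρ : A.GeometricPriors ρ) : A.law (A.phiEq S hS 1) ≠ 0 := by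
  intro h
  have h1 := A.tsum_law_phiEq S hS
  rw [ENNReal.tsum_eq_zero.2] at h1
  · exact zero_ne_one h1
  · rintro (_ | n)
    · exact A.law_phiEq_zero S hS
    · rw [A.law_phiEq_succ S hS hρ, h, mul_zero]

/-- After a shift by `n` all change points in `S` exceed `n`, so up to time `n` the likelihood
cannot tell them from `∞`. This gives `likInfty` a meaning under the actual law, through the event
`φ > n`. -/
theorem tsum_weight_mul_likelihood (hρ : A.GeometricPriors ρ) (n : ℕ) (x : A.Obs) :
    ∑' m, (if n < S.inf' hS m then A.weight m else 0) * A.likelihood n (fun j => (m j : ℕ∞)) x =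
      ENNReal.ofReal (Real.exp (-qPhi ρ S * n)) * A.likInfty S n x := by
  have := A.tsum_weight_shift S hS hρ n fun m => A.likelihood n (fun j => (m j : ℕ∞)) x
  simp only [ite_mul, zero_mul]
  rw [this, likInfty]
  congr 1
  refine tsum_congr fun m => ?_
  by_cases hm : A.weight m = 0
  · rw [hm, zero_mul, ← weight, hm, zero_mul]
  rw [weight]
  congr 1
  refine A.likelihood_congr (fun j t ht => ?_) x
  unfold shift
  split_ifs with hj
  · have := A.weight_ne_zero_pos hm j
    simp only [ENat.natCast_lt_top, iff_true, Nat.cast_lt]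
    omega
  · rfl

/-- Change of measure from `φ = k` to `φ = ∞`, on the past of time `n`. -/
theorem lawPhi_le_of_likPhi_le (hρ : A.GeometricPriors ρ) {k n : ℕ} {B : Set A.Sample}
    (hB : MeasurableSet[A.filtration n] B) {c : ℝ≥0∞}
    (h : ∀ ω ∈ B, A.likPhi S hS k n ω.2 ≤ c * A.likInfty S n ω.2) :
    ENNReal.ofReal (Real.exp (-qPhi ρ S * n)) * A.lawPhi S hS k B ≤
      c * A.law (B ∩ {ω | n < A.phi S hS ω}) := by
  set r := ENNReal.ofReal (Real.exp (-qPhi ρ S * n))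
  have hB' := A.filtration.le n B hB
  have := A.tsum_slice_le_of_likelihood_le hB (a := fun m => r * A.piPhi S hS k m)
    (b := fun m => c * if n < S.inf' hS m then A.weight m else 0) fun ω hω => by
      simp_rw [mul_assoc, ENNReal.tsum_mul_left]
      rw [A.tsum_weight_mul_likelihood S hS hρ, mul_left_comm c]
      exact mul_le_mul_right (h ω hω) r
  simp_rw [mul_assoc, ENNReal.tsum_mul_left] at this
  rw [A.lawPhi_apply S hS k hB']
  refine this.trans_eq ?_
  congr 1
  simp only [ite_mul, zero_mul]
  exact (A.law_inter_fst (fun m => n < S.inf' hS m) hB').symm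

/-- Of the event `φ ≤ n` only the part `φ = k` is used, which is why `k ≤ n` is needed. -/
theorem law_phi_gt_le_of_likInfty_le (hρ : A.GeometricPriors ρ) {k n : ℕ} (hkn : k ≤ n)
    {B : Set A.Sample} (hB : MeasurableSet[A.filtration n] B) {a b : ℝ≥0∞}
    (h : ∀ ω ∈ B, a * (ENNReal.ofReal (Real.exp (-qPhi ρ S * n)) * A.likInfty S n ω.2) ≤
      b * (A.law (A.phiEq S hS k) * A.likPhi S hS k n ω.2)) :
    a * A.law (B ∩ {ω | n < A.phi S hS ω}) ≤ b * A.law (B ∩ {ω | A.phi S hS ω ≤ n}) := by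
  have hB' := A.filtration.le n B hB
  have := A.tsum_slice_le_of_likelihood_le hB
    (a := fun m => a * if n < S.inf' hS m then A.weight m else 0)
    (b := fun m => b * (A.law (A.phiEq S hS k) * A.piPhi S hS k m)) fun ω hω => by
      simp_rw [mul_assoc, ENNReal.tsum_mul_left]
      rw [A.tsum_weight_mul_likelihood S hS hρ]
      exact h ω hω
  simp_rw [mul_assoc, ENNReal.tsum_mul_left] at this
  calc a * A.law (B ∩ {ω | n < A.phi S hS ω})
      = a * ∑' m, (if n < S.inf' hS m then A.weight m else 0) * A.slice m B := by
        congr 1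
        simp only [ite_mul, zero_mul]
        exact A.law_inter_fst (fun m => n < S.inf' hS m) hB'
    _ ≤ _ := this
    _ ≤ _ := by
        gcongr
        rw [← lawPhi_apply A S hS k hB', lawPhi, mul_comm,
          cond_mul_eq_inter (A.measurableSet_phiEq S hS k), Set.inter_comm]
        refine measure_mono (Set.inter_subset_inter_right _ fun ω hω => ?_)
        exact (le_of_eq hω).trans hkn

/-! ### The posterior probability of a past change -/

theorem measurableSet_phi_le (n : ℕ) : MeasurableSet {ω | A.phi S hS ω ≤ n} :=
  A.measurableSet_fst fun m => S.inf' hS m ≤ n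

theorem measurableSet_phi_gt (n : ℕ) : MeasurableSet {ω | n < A.phi S hS ω} :=
  A.measurableSet_fst fun m => n < S.inf' hS m

theorem stronglyMeasurable_posterior (n : ℕ) :
    StronglyMeasurable[A.filtration n] (A.posterior S hS n) := stronglyMeasurable_condExp

theorem measurableSet_le_posterior (a : ℝ) (n : ℕ) :
    MeasurableSet[A.filtration n] {ω | a ≤ A.posterior S hS n ω} :=
  (A.stronglyMeasurable_posterior S hS n).measurable measurableSet_Ici

theorem setIntegral_posterior {n : ℕ} {B : Set A.Sample} (hB : MeasurableSet[A.filtration n] B) :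
    ∫ ω in B, A.posterior S hS n ω ∂A.law = A.law.real (B ∩ {ω | A.phi S hS ω ≤ n}) := by
  rw [posterior, setIntegral_condExp (A.filtration.le n)
    ((integrable_const (1 : ℝ)).indicator (A.measurableSet_phi_le S hS n)) hB,
    setIntegral_indicator (A.measurableSet_phi_le S hS n)]
  simp

theorem measure_eq_add_phi (n : ℕ) (B : Set A.Sample) :
    A.law.real B = A.law.real (B ∩ {ω | A.phi S hS ω ≤ n}) +
      A.law.real (B ∩ {ω | n < A.phi S hS ω}) := by
  rw [← measureReal_inter_add_sdiff (A.measurableSet_phi_le S hS n) (s := B)]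
  congr 2
  ext ω
  simp

/-- On the part `B` of `E` where the posterior is below `1 - α`, the function `1 - α - posterior` is
positive, but by the odds inequality its integral is at most zero; hence `B` is null. -/
theorem ae_le_posterior {n : ℕ} {α : ℝ} {E : Set A.Sample}
    (hE : MeasurableSet[A.filtration n] E)
    (h : ∀ B ⊆ E, MeasurableSet[A.filtration n] B →
      (1 - α) * A.law.real (B ∩ {ω | n < A.phi S hS ω}) ≤
        α * A.law.real (B ∩ {ω | A.phi S hS ω ≤ n})) :
    ∀ᵐ ω ∂A.law, ω ∈ E → 1 - α ≤ A.posterior S hS n ω := by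
  set B := E ∩ {ω | 1 - α ≤ A.posterior S hS n ω}ᶜ with hB_def
  have hB : MeasurableSet[A.filtration n] B :=
    hE.inter (A.measurableSet_le_posterior S hS (1 - α) n).compl
  have hB' := A.filtration.le n B hB
  have h1 := h B Set.inter_subset_left hB
  have h2 := A.setIntegral_posterior S hS hB
  have h3 := A.measure_eq_add_phi S hS n B
  have hint : Integrable (A.posterior S hS n) A.law := integrable_condExp
  have h4 : ∫ ω in B, ((1 - α) - A.posterior S hS n ω) ∂A.law ≤ 0 := by
    rw [integral_sub (integrable_const _) hint.integrableOn, h2]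
    simp only [integral_const, measureReal_restrict_apply_univ, smul_eq_mul]
    rw [h3]
    linarith
  have hnn : 0 ≤ᵐ[A.law.restrict B] fun ω => (1 - α) - A.posterior S hS n ω := by
    filter_upwards [ae_restrict_mem hB'] with ω hω
    have := hω.2
    simp only [Set.mem_compl_iff, Set.mem_ofPred_eq, not_le] at this
    simp only [Pi.zero_apply]
    linarith
  have h5 := (integral_eq_zero_iff_of_nonneg_ae hnn
    ((integrable_const _).sub hint.integrableOn)).1 (le_antisymm h4 (integral_nonneg_of_ae hnn))
  rw [Filter.EventuallyEq, ae_restrict_iff' hB'] at h5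
  filter_upwards [h5] with ω hω hωE
  by_contra hlt
  have := hω ⟨hωE, hlt⟩
  simp only [Pi.zero_apply] at this
  exact hlt (by linarith)

end ChangePoint.Model

/-! ### Stopping rules: delay, lower bound, and the rule `τ_S`. -/

namespace ChangePoint.Model

variable {d : ℕ} {𝓧 : Type*} [MeasurableSpace 𝓧] (A : Model d 𝓧)
  (S : Finset (Fin d)) (hS : S.Nonempty) {ρ : Fin d → ℝ}

/-- The mean of the positive part of `τ - φ`. -/
noncomputable def meanExcess (τ : A.Sample → ℕ∞) : ℝ≥0∞ :=
  ∫⁻ ω, ((τ ω - (A.phi S hS ω : ℕ∞) : ℕ∞) : ℝ≥0∞) ∂A.law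

variable {A} {τ : A.Sample → ℕ∞}

theorem measurableSet_stopping_le (hτ : IsStoppingTime A.filtration τ) (n : ℕ) :
    MeasurableSet[A.filtration n] {ω | τ ω ≤ (n : ℕ∞)} := hτ n

theorem measurableSet_stopping_eq (hτ : IsStoppingTime A.filtration τ) (n : ℕ) :
    MeasurableSet[A.filtration n] {ω | τ ω = (n : ℕ∞)} := hτ.measurableSet_eq n

theorem measurableSet_stopping_le_phi_add (hτ : IsStoppingTime A.filtration τ) (N : ℕ) :
    MeasurableSet {ω | τ ω ≤ (A.phi S hS ω : ℕ∞) + N} := by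
  have : {ω | τ ω ≤ (A.phi S hS ω : ℕ∞) + N} =
      ⋃ k : ℕ, A.phiEq S hS k ∩ {ω | τ ω ≤ ((k + N : ℕ) : ℕ∞)} := by
    ext ω
    simp [phiEq]
  rw [this]
  exact MeasurableSet.iUnion fun k => (A.measurableSet_phiEq S hS k).inter
    (A.filtration.le _ _ (measurableSet_stopping_le hτ _))

theorem measurableSet_stopping_lt_phi (hτ : IsStoppingTime A.filtration τ) :
    MeasurableSet {ω | τ ω < (A.phi S hS ω : ℕ∞)} := by
  have : {ω | τ ω < (A.phi S hS ω : ℕ∞)} =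
      ⋃ k : ℕ, {ω | τ ω = (k : ℕ∞)} ∩ {ω | k < A.phi S hS ω} := by
    ext ω
    simp only [Set.mem_ofPred_eq, Set.mem_iUnion, Set.mem_inter_iff]
    constructor
    · intro h
      obtain ⟨k, hk⟩ := ENat.ne_top_iff_exists.1 h.ne_top
      rw [← hk] at h ⊢
      exact ⟨k, rfl, by exact_mod_cast h⟩
    · rintro ⟨k, hk, h⟩
      rw [hk]
      exact_mod_cast h
  rw [this]
  exact MeasurableSet.iUnion fun k => (A.filtration.le _ _ (measurableSet_stopping_eq hτ _)).inter
    (A.measurableSet_phi_gt S hS k)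

theorem measurableSet_phi_le_stopping (hτ : IsStoppingTime A.filtration τ) :
    MeasurableSet {ω | (A.phi S hS ω : ℕ∞) ≤ τ ω} := by
  convert (measurableSet_stopping_lt_phi S hS hτ).compl using 1
  ext ω
  simp

/-- Truncated subtraction makes the integrand vanish where `τ < φ`, so conditioning only divides by
the probability of `φ ≤ τ`. -/
theorem delay_eq (hτ : IsStoppingTime A.filtration τ) :
    A.delay S hS τ = (A.law {ω | (A.phi S hS ω : ℕ∞) ≤ τ ω})⁻¹ * A.meanExcess S hS τ := by
  rw [delay, ProbabilityTheory.cond, lintegral_smul_measure, smul_eq_mul,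
    ← lintegral_indicator (measurableSet_phi_le_stopping S hS hτ), meanExcess]
  congr 2
  funext ω
  by_cases h : (A.phi S hS ω : ℕ∞) ≤ τ ω
  · exact Set.indicator_of_mem (s := {ω | (A.phi S hS ω : ℕ∞) ≤ τ ω}) h _
  · rw [Set.indicator_of_notMem (s := {ω | (A.phi S hS ω : ℕ∞) ≤ τ ω}) h,
      tsub_eq_zero_of_le (not_le.1 h).le, ENat.toENNReal_zero]

theorem meanExcess_le_delay (hτ : IsStoppingTime A.filtration τ) :
    A.meanExcess S hS τ ≤ A.delay S hS τ := by
  rw [delay_eq S hS hτ]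
  exact le_mul_of_one_le_left' (ENNReal.one_le_inv.2 prob_le_one)

theorem delay_le (hτ : IsStoppingTime A.filtration τ) {a : ℝ≥0∞}
    (h : a ≤ A.law {ω | (A.phi S hS ω : ℕ∞) ≤ τ ω}) :
    A.delay S hS τ ≤ a⁻¹ * A.meanExcess S hS τ := by
  rw [delay_eq S hS hτ]
  gcongr

theorem meanExcess_add_one_le (τ : A.Sample → ℕ∞) :
    A.meanExcess S hS (fun ω => τ ω + 1) ≤ A.meanExcess S hS τ + 1 := by
  have h : A.meanExcess S hS τ + 1 =
      ∫⁻ ω, (((τ ω - (A.phi S hS ω : ℕ∞) : ℕ∞) : ℝ≥0∞) + 1) ∂A.law := by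
    rw [lintegral_add_right _ measurable_const]
    simp [meanExcess]
  rw [h]
  refine lintegral_mono fun ω => ?_
  rw [← ENat.toENNReal_one, ← ENat.toENNReal_add, ENat.toENNReal_le, tsub_le_iff_right,
    add_right_comm]
  exact add_le_add le_tsub_add le_rfl

/-- Markov's inequality. -/
theorem mul_le_meanExcess (hτ : IsStoppingTime A.filtration τ) (N : ℕ) :
    N * A.law {ω | (A.phi S hS ω : ℕ∞) + N < τ ω} ≤ A.meanExcess S hS τ := by
  have hmeas : MeasurableSet {ω | (A.phi S hS ω : ℕ∞) + N < τ ω} := by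
    convert (measurableSet_stopping_le_phi_add S hS hτ N).compl using 1
    ext ω
    simp
  rw [← lintegral_indicator_const hmeas]
  refine lintegral_mono fun ω => ?_
  by_cases h : (A.phi S hS ω : ℕ∞) + N < τ ω
  · rw [Set.indicator_of_mem (s := {ω | (A.phi S hS ω : ℕ∞) + N < τ ω}) h, ← ENat.toENNReal_coe,
      ENat.toENNReal_le]
    refine ENat.le_sub_of_add_le_left (ENat.natCast_ne_top _) h.le
  · rw [Set.indicator_of_notMem (s := {ω | (A.phi S hS ω : ℕ∞) + N < τ ω}) h]
    exact zero_le

/-! ### The lower bound -/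

/-- Between `φ` and `φ + N`, a rule with few false alarms seldom stops, unless the marginal
likelihood ratio is large. -/
theorem lawPhi_stopping_le (hρ : A.GeometricPriors ρ) {α : ℝ}
    (hτ : τ ∈ A.ruleClass S hS α) (k N : ℕ) (c : ℝ) :
    A.lawPhi S hS k {ω | (k : ℕ∞) < τ ω ∧ τ ω ≤ (k : ℕ∞) + N} ≤
      ENNReal.ofReal (α * Real.exp (c + qPhi ρ S * (k + N))) +
        A.lawPhi S hS k {ω | (c : EReal) ≤
          ⨆ n ∈ Finset.Icc 1 N, ENNReal.log (A.D S hS k (k + n) ω)} := by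
  set H := {ω | (c : EReal) ≤ ⨆ n ∈ Finset.Icc 1 N, ENNReal.log (A.D S hS k (k + n) ω)}
  have hq := A.qPhi_pos S hS hρ
  -- Off `H`, the ratio `D` is below `exp c` at the moment of stopping. Each `B n` is known at time
  -- `k + n`, so the change of measure applies to it.
  let B : ℕ → Set A.Sample := fun n =>
    {ω | τ ω = ((k + n : ℕ) : ℕ∞)} ∩ {ω | A.D S hS k (k + n) ω ≤ ENNReal.ofReal (Real.exp c)}
  have hB : ∀ n, MeasurableSet[A.filtration (k + n)] (B n) := fun n =>
    (measurableSet_stopping_eq hτ.1 _).inter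
      (A.measurable_filtration_D S hS k (k + n) measurableSet_Iic)
  have hsub : {ω | (k : ℕ∞) < τ ω ∧ τ ω ≤ (k : ℕ∞) + N} ⊆ (⋃ n ∈ Finset.Icc 1 N, B n) ∪ H := by
    rintro ω ⟨h1, h2⟩
    by_cases hω : ω ∈ H
    · exact Or.inr hω
    left
    have hfin : τ ω ≠ ⊤ := ne_top_of_le_ne_top (by exact_mod_cast ENat.natCast_ne_top (k + N)) h2
    obtain ⟨a, ha⟩ := ENat.ne_top_iff_exists.1 hfin
    rw [← ha] at h1 h2
    have h1' : k < a := by exact_mod_cast h1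
    have h2' : a ≤ k + N := by exact_mod_cast h2
    have hn : a - k ∈ Finset.Icc 1 N := Finset.mem_Icc.2 ⟨by omega, by omega⟩
    refine Set.mem_iUnion₂.2 ⟨a - k, hn, ?_, ?_⟩
    · rw [Set.mem_ofPred_eq, ← ha, Nat.add_sub_cancel' h1'.le]
    · have hlt := (le_iSup₂ (f := fun n (_ : n ∈ Finset.Icc 1 N) =>
        ENNReal.log (A.D S hS k (k + n) ω)) (a - k) hn).trans_lt (not_le.1 hω)
      rw [← Real.log_exp c, ← ENNReal.log_ofReal_of_pos (Real.exp_pos c),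
        ENNReal.log_lt_log_iff] at hlt
      exact hlt.le
  refine (measure_mono hsub).trans ((measure_union_le _ _).trans ?_)
  gcongr
  have hBn : ∀ n ∈ Finset.Icc 1 N, A.lawPhi S hS k (B n) ≤
      ENNReal.ofReal (Real.exp (c + qPhi ρ S * (k + N))) *
        A.law ({ω | τ ω = ((k + n : ℕ) : ℕ∞)} ∩ {ω | τ ω ≤ (A.phi S hS ω : ℕ∞)}) := by
    intro n hn
    have h := A.lawPhi_le_of_likPhi_le S hS hρ (k := k) (hB n)
      (c := ENNReal.ofReal (Real.exp c)) fun ω hω =>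
        (ENNReal.div_le_iff_le_mul (Or.inr ENNReal.ofReal_ne_top)
          (Or.inl (A.likInfty_ne_top S _ _))).1 hω.2
    have hnN : (n : ℝ) ≤ N := by exact_mod_cast (Finset.mem_Icc.1 hn).2
    calc A.lawPhi S hS k (B n)
        = ENNReal.ofReal (Real.exp (qPhi ρ S * (k + n : ℕ))) *
          (ENNReal.ofReal (Real.exp (-qPhi ρ S * (k + n : ℕ))) * A.lawPhi S hS k (B n)) := by
          rw [← mul_assoc, ← ENNReal.ofReal_mul (Real.exp_pos _).le, ← Real.exp_add, neg_mul,
            add_neg_cancel, Real.exp_zero, ENNReal.ofReal_one, one_mul]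
      _ ≤ ENNReal.ofReal (Real.exp (qPhi ρ S * (k + n : ℕ))) *
          (ENNReal.ofReal (Real.exp c) * A.law (B n ∩ {ω | k + n < A.phi S hS ω})) := by gcongr
      _ ≤ _ := by
          rw [← mul_assoc, ← ENNReal.ofReal_mul (Real.exp_pos _).le, ← Real.exp_add]
          refine mul_le_mul' (ENNReal.ofReal_le_ofReal (Real.exp_le_exp.2 ?_))
            (measure_mono fun ω hω => ⟨hω.1.1, ?_⟩)
          · push_cast
            have : qPhi ρ S * (k + n) ≤ qPhi ρ S * (k + N) := by gcongr
            linarith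
          · have h1 : τ ω = ((k + n : ℕ) : ℕ∞) := hω.1.1
            rw [Set.mem_ofPred_eq, h1]
            exact_mod_cast (show k + n < A.phi S hS ω from hω.2).le
  have hle_meas : MeasurableSet {ω | τ ω ≤ (A.phi S hS ω : ℕ∞)} := by
    simpa using measurableSet_stopping_le_phi_add S hS hτ.1 0
  calc A.lawPhi S hS k (⋃ n ∈ Finset.Icc 1 N, B n)
      ≤ ∑ n ∈ Finset.Icc 1 N, A.lawPhi S hS k (B n) := measure_biUnion_finset_le _ _
    _ ≤ _ := Finset.sum_le_sum hBn
    _ ≤ ENNReal.ofReal (Real.exp (c + qPhi ρ S * (k + N))) * ENNReal.ofReal α := by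
        rw [← Finset.mul_sum]
        -- The events `τ = k + n` are disjoint in `n` and intersected with `τ ≤ φ`, so together they
        -- cost at most one false alarm probability.
        refine mul_le_mul_right ?_ _
        rw [← measure_biUnion_finset]
        · refine (measure_mono (Set.iUnion₂_subset fun n _ => Set.inter_subset_right)).trans hτ.2
        · intro a _ b _ hab
          refine Set.disjoint_left.2 fun ω ha hb => hab ?_
          have h1 : τ ω = ((k + a : ℕ) : ℕ∞) := ha.1
          have h2 : τ ω = ((k + b : ℕ) : ℕ∞) := hb.1
          rw [h1] at h2
          have h3 : k + a = k + b := by exact_mod_cast h2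
          omega
        · exact fun n _ => (A.filtration.le _ _ (measurableSet_stopping_eq hτ.1 _)).inter hle_meas
    _ = _ := by rw [← ENNReal.ofReal_mul (Real.exp_pos _).le, mul_comm]

theorem law_stopping_eq_tsum (hτ : IsStoppingTime A.filtration τ) (N : ℕ) :
    A.law {ω | (A.phi S hS ω : ℕ∞) < τ ω ∧ τ ω ≤ (A.phi S hS ω : ℕ∞) + N} =
      ∑' k, A.law (A.phiEq S hS k) *
        A.lawPhi S hS k {ω | (k : ℕ∞) < τ ω ∧ τ ω ≤ (k : ℕ∞) + N} := by
  have hm : ∀ k : ℕ, MeasurableSet {ω | (k : ℕ∞) < τ ω ∧ τ ω ≤ (k : ℕ∞) + N} := by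
    intro k
    have : {ω | (k : ℕ∞) < τ ω ∧ τ ω ≤ (k : ℕ∞) + N} =
        {ω | τ ω ≤ ((k + N : ℕ) : ℕ∞)} \ {ω | τ ω ≤ (k : ℕ∞)} := by
      ext ω
      simp [and_comm]
    rw [this]
    exact (A.filtration.le _ _ (measurableSet_stopping_le hτ _)).diff
      (A.filtration.le _ _ (measurableSet_stopping_le hτ _))
  have : {ω | (A.phi S hS ω : ℕ∞) < τ ω ∧ τ ω ≤ (A.phi S hS ω : ℕ∞) + N} =
      ⋃ k : ℕ, A.phiEq S hS k ∩ {ω | (k : ℕ∞) < τ ω ∧ τ ω ≤ (k : ℕ∞) + N} := by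
    ext ω
    simp [phiEq]
  rw [this, measure_iUnion]
  · refine tsum_congr fun k => ?_
    rw [lawPhi, mul_comm, cond_mul_eq_inter (A.measurableSet_phiEq S hS k)]
  · intro a b hab
    refine Set.disjoint_left.2 fun ω ha hb => hab ?_
    exact ha.1.symm.trans hb.1
  · exact fun k => (A.measurableSet_phiEq S hS k).inter (hm k)

end ChangePoint.Model

theorem measurableSet_mul_le_mul {Ω : Type*} {_ : MeasurableSpace Ω} {f g : Ω → ℝ≥0∞}
    (hf : Measurable f) (hg : Measurable g) (a b c : ℝ≥0∞) :
    MeasurableSet {ω | a * f ω ≤ b * (c * g ω)} :=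
  measurableSet_le (hf.const_mul a) ((hg.const_mul c).const_mul b)

namespace ChangePoint.Model

variable {d : ℕ} {𝓧 : Type*} [MeasurableSpace 𝓧] {A : Model d 𝓧}
  (S : Finset (Fin d)) (hS : S.Nonempty) {ρ : Fin d → ℝ} {α : ℝ}

/-! ### The stopping rule `τ_S` -/

theorem tau_le_iff {ω : A.Sample} {n : ℕ} : A.tau S hS α ω ≤ (n : ℕ∞) ↔
    ∃ i, 1 ≤ i ∧ i ≤ n ∧ 1 - α ≤ A.posterior S hS i ω := by
  constructor
  · intro h
    by_contra! hn
    have : ((n + 1 : ℕ) : ℕ∞) ≤ A.tau S hS α ω := by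
      refine le_iInf₂ fun i hi => ?_
      by_contra hlt
      have hlt' : i < n + 1 := by exact_mod_cast not_le.1 hlt
      exact absurd hi.2 (not_le.2 (hn i hi.1 (by omega)))
    have h' : n + 1 ≤ n := by exact_mod_cast this.trans h
    omega
  · rintro ⟨i, h1, h2, h3⟩
    exact (iInf₂_le i ⟨h1, h3⟩).trans (by exact_mod_cast h2)

theorem le_posterior_of_tau_eq {ω : A.Sample} {n : ℕ} (h : A.tau S hS α ω = (n : ℕ∞)) :
    1 - α ≤ A.posterior S hS n ω := by
  obtain ⟨i, h1, h2, h3⟩ := (tau_le_iff S hS).1 h.le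
  have : (n : ℕ∞) ≤ i := h ▸ (tau_le_iff S hS).2 ⟨i, h1, le_rfl, h3⟩
  have hi : n = i := le_antisymm (by exact_mod_cast this) h2
  rwa [hi]

theorem isStoppingTime_tau : IsStoppingTime A.filtration (A.tau S hS α) := by
  intro n
  have : {ω | A.tau S hS α ω ≤ (n : ℕ∞)} =
      ⋃ i : ℕ, ⋃ (_ : 1 ≤ i ∧ i ≤ n), {ω | 1 - α ≤ A.posterior S hS i ω} := by
    ext ω
    simp only [Set.mem_ofPred_eq, tau_le_iff, Set.mem_iUnion, exists_prop, and_assoc]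
  refine this ▸ MeasurableSet.iUnion fun i => MeasurableSet.iUnion fun hi => ?_
  exact A.filtration.mono hi.2 _ (A.measurableSet_le_posterior S hS (1 - α) i)

theorem isStoppingTime_add_one {τ : A.Sample → ℕ∞} (hτ : IsStoppingTime A.filtration τ) :
    IsStoppingTime A.filtration (fun ω => τ ω + 1 : A.Sample → ℕ∞) := by
  intro n
  change MeasurableSet[A.filtration n] {ω | τ ω + 1 ≤ (n : ℕ∞)}
  rcases n with _ | n
  · have : {ω | τ ω + 1 ≤ ((0 : ℕ) : ℕ∞)} = ∅ := by
      ext ω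
      simp
    exact this ▸ @MeasurableSet.empty _ (A.filtration 0)
  · have : {ω | τ ω + 1 ≤ ((n + 1 : ℕ) : ℕ∞)} = {ω | τ ω ≤ (n : ℕ∞)} := by
      ext ω
      simp only [Set.mem_ofPred_eq, Nat.cast_add, Nat.cast_one]
      exact ENat.add_le_add_iff_right ENat.one_ne_top
    exact this ▸ A.filtration.mono n.le_succ _ (hτ n)

/-- On `τ_S = n` the posterior is at least `1 - α`, so `φ > n` takes up at most the share `α` of
that event; sum over `n`. -/
theorem law_tau_lt_phi_le (hα : 0 ≤ α) :
    A.law {ω | A.tau S hS α ω < (A.phi S hS ω : ℕ∞)} ≤ ENNReal.ofReal α := by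
  let B : ℕ → Set A.Sample := fun n => {ω | A.tau S hS α ω = (n : ℕ∞)}
  have hB : ∀ n, MeasurableSet[A.filtration n] (B n) :=
    measurableSet_stopping_eq (isStoppingTime_tau S hS)
  have hB' := fun n => A.filtration.le n _ (hB n)
  have hBn : ∀ n, A.law (B n ∩ {ω | n < A.phi S hS ω}) ≤ ENNReal.ofReal α * A.law (B n) := by
    intro n
    have h1 := A.setIntegral_posterior S hS (hB n)
    have h2 := A.measure_eq_add_phi S hS n (B n)
    have h3 : (1 - α) * A.law.real (B n) ≤ ∫ ω in B n, A.posterior S hS n ω ∂A.law := by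
      have : ∫ _ in B n, (1 - α) ∂A.law = (1 - α) * A.law.real (B n) := by
        simp [mul_comm]
      rw [← this]
      exact setIntegral_mono_on (integrable_const _) integrable_condExp.integrableOn (hB' n)
        fun ω hω => le_posterior_of_tau_eq S hS hω
    rw [← ofReal_measureReal, ← ofReal_measureReal, ← ENNReal.ofReal_mul hα]
    exact ENNReal.ofReal_le_ofReal (by linarith)
  have hsub : {ω | A.tau S hS α ω < (A.phi S hS ω : ℕ∞)} ⊆
      ⋃ n, B n ∩ {ω | n < A.phi S hS ω} := by
    intro ω hω
    obtain ⟨n, hn⟩ := ENat.ne_top_iff_exists.1 (ne_top_of_lt (Set.mem_ofPred_eq ▸ hω))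
    refine Set.mem_iUnion.2 ⟨n, hn.symm, ?_⟩
    have h : A.tau S hS α ω < (A.phi S hS ω : ℕ∞) := hω
    rw [← hn] at h
    exact_mod_cast h
  calc A.law {ω | A.tau S hS α ω < (A.phi S hS ω : ℕ∞)}
      ≤ ∑' n, A.law (B n ∩ {ω | n < A.phi S hS ω}) :=
        (measure_mono hsub).trans (measure_iUnion_le _)
    _ ≤ ∑' n, ENNReal.ofReal α * A.law (B n) := ENNReal.tsum_le_tsum hBn
    _ = ENNReal.ofReal α * A.law (⋃ n, B n) := by
        rw [ENNReal.tsum_mul_left, measure_iUnion _ hB']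
        intro a b hab
        refine Set.disjoint_left.2 fun ω ha hb => hab ?_
        have h1 : A.tau S hS α ω = (a : ℕ∞) := ha
        have h2 : A.tau S hS α ω = (b : ℕ∞) := hb
        rw [h1] at h2
        exact_mod_cast h2
    _ ≤ _ := mul_le_of_le_one_right' prob_le_one

/-- A false alarm is `τ ≤ φ`, whereas `τ_S` only controls `τ_S < φ`. One extra step closes this gap
and does not affect the asymptotics. -/
theorem tau_add_one_mem_ruleClass (hα : 0 ≤ α) :
    (fun ω => A.tau S hS α ω + 1) ∈ A.ruleClass S hS α := by
  refine ⟨isStoppingTime_add_one (isStoppingTime_tau S hS),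
    (measure_mono fun ω hω => ?_).trans (law_tau_lt_phi_le S hS hα)⟩
  have h : A.tau S hS α ω + 1 ≤ (A.phi S hS ω : ℕ∞) := hω
  exact (ENat.add_one_le_iff (by
    intro htop
    rw [htop] at h
    exact absurd h (by simp))).1 h

theorem one_sub_le_law_phi_le_tau (hα : 0 ≤ α) :
    1 - ENNReal.ofReal α ≤ A.law {ω | (A.phi S hS ω : ℕ∞) ≤ A.tau S hS α ω} := by
  have hm := measurableSet_stopping_lt_phi (A := A) S hS (isStoppingTime_tau (A := A) (α := α) S hS)
  have : {ω | (A.phi S hS ω : ℕ∞) ≤ A.tau S hS α ω} =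
      {ω | A.tau S hS α ω < (A.phi S hS ω : ℕ∞)}ᶜ := by
    ext ω
    simp
  rw [this, prob_compl_eq_one_sub hm]
  exact tsub_le_tsub_left (law_tau_lt_phi_le S hS hα) 1

/-! ### The upper bound -/

theorem ae_slice_of_ae_law {P : A.Sample → Prop} (h : ∀ᵐ ω ∂A.law, P ω) {m : Fin d → ℕ}
    (hm : A.weight m ≠ 0) : ∀ᵐ ω ∂A.slice m, P ω := by
  rw [law_eq, Measure.ae_sum_iff] at h
  exact (Measure.ae_ennreal_smul_measure_iff hm).1 (h m)

/-- The hypothesis compares the joint weights of `φ > n` and `φ = k` with the data: once their ratio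
is at most `α`, so is the posterior probability of `φ > n`. -/
theorem ae_forall_le_posterior (hρ : A.GeometricPriors ρ) (hα : 0 ≤ α) (hα1 : α ≤ 1) :
    ∀ᵐ ω ∂A.law, ∀ k n : ℕ, k ≤ n →
      ENNReal.ofReal (Real.exp (-qPhi ρ S * n)) * A.likInfty S n ω.2 ≤
        ENNReal.ofReal α * (A.law (A.phiEq S hS k) * A.likPhi S hS k n ω.2) →
      1 - α ≤ A.posterior S hS n ω := by
  rw [ae_all_iff]
  intro k
  rw [ae_all_iff]
  intro n
  by_cases hkn : k ≤ n
  swap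
  · exact Eventually.of_forall fun ω h => absurd h hkn
  have hE : MeasurableSet[A.filtration n]
      {ω : A.Sample | ENNReal.ofReal (Real.exp (-qPhi ρ S * n)) * A.likInfty S n ω.2 ≤
        ENNReal.ofReal α * (A.law (A.phiEq S hS k) * A.likPhi S hS k n ω.2)} :=
    measurableSet_mul_le_mul (A.measurable_filtration_likInfty S n)
      (A.measurable_filtration_likPhi S hS k n) _ _ _
  filter_upwards [A.ae_le_posterior S hS (α := α) hE fun B hBE hB => by
    have h := A.law_phi_gt_le_of_likInfty_le S hS hρ hkn hB (a := ENNReal.ofReal (1 - α))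
      (b := ENNReal.ofReal α) fun ω hω =>
        (mul_le_of_le_one_left' (ENNReal.ofReal_le_one.2 (by linarith))).trans (hBE hω)
    rw [← ofReal_measureReal, ← ofReal_measureReal, ← ENNReal.ofReal_mul (by linarith),
      ← ENNReal.ofReal_mul hα] at h
    exact (ENNReal.ofReal_le_ofReal_iff (by positivity)).1 h] with ω hω _ h
  exact hω h

/-- The rule `τ_S` stops soon after `log D_φ^k` has started to grow at its normal rate. -/
theorem tau_sub_le (hρ : A.GeometricPriors ρ) (hα : 0 < α) (hinfo : A.info S ≠ ∞) {ω : A.Sample}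
    (hω : ∀ k n : ℕ, k ≤ n →
      ENNReal.ofReal (Real.exp (-qPhi ρ S * n)) * A.likInfty S n ω.2 ≤
        ENNReal.ofReal α * (A.law (A.phiEq S hS k) * A.likPhi S hS k n ω.2) →
      1 - α ≤ A.posterior S hS n ω)
    {δ x : ℝ} (hδ : 0 ≤ qPhi ρ S + (A.info S).toReal - δ)
    (hx : -Real.log α - Real.log (A.law (A.phiEq S hS 1)).toReal ≤
      x * (qPhi ρ S + (A.info S).toReal - δ)) {k : ℕ} (hk : 1 ≤ k) :
    ((A.tau S hS α ω - (k : ℕ∞) : ℕ∞) : ℝ≥0∞) ≤ A.T S hS δ k ω + (⌈x⌉₊ : ℕ) := by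
  by_cases htop : A.T S hS δ k ω = ∞
  · simp [htop]
  set t := ⌊(A.T S hS δ k ω).toReal⌋₊ with ht
  -- The least convenient integer exceeding `T` and at least `x`: the first makes `D` large at time
  -- `k + ν - 1`, the second makes its growth outweigh `α` and `π₁`. The resulting delay is `ν - 1`.
  set ν := t + 1 + ⌈x⌉₊ with hν
  set I := (A.info S).toReal
  set π₁ := A.law (A.phiEq S hS 1) with hπ₁
  have hπ0 : 0 < π₁.toReal :=
    ENNReal.toReal_pos (A.law_phiEq_one_ne_zero S hS hρ) (by finiteness)
  have hxν : x ≤ ν := (Nat.le_ceil x).trans (by exact_mod_cast (by omega))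
  have hTν : A.T S hS δ k ω < ν := by
    rw [← ENNReal.ofReal_toReal htop, ← ENNReal.ofReal_natCast]
    refine (ENNReal.ofReal_lt_ofReal_iff (by positivity)).2 ?_
    refine (Nat.lt_floor_add_one _).trans_le ?_
    exact_mod_cast (by omega)
  have hD : ENNReal.ofReal (Real.exp (ν * (I - δ))) ≤ A.D S hS k (k + ν - 1) ω := by
    by_contra hlt
    have hν0 : (0 : EReal) < ((ν : ℝ) : EReal) := by exact_mod_cast (by omega : 0 < ν)
    have : (ν : ℝ≥0∞) ≤ A.T S hS δ k ω := by
      refine le_iSup₂ (f := fun (n : ℕ) (_ : 1 ≤ n ∧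
        ENNReal.log (A.D S hS k (k + n - 1) ω) / ((n : ℝ) : EReal) <
          (A.info S : EReal) - (δ : EReal)) => (n : ℝ≥0∞)) ν ⟨by omega, ?_⟩
      rw [← EReal.coe_ennreal_toReal hinfo, ← EReal.coe_sub,
        EReal.div_lt_iff hν0 (EReal.coe_ne_top _), ← EReal.coe_mul, mul_comm,
        ← Real.log_exp (ν * _), ← ENNReal.log_ofReal_of_pos (Real.exp_pos _),
        ENNReal.log_lt_log_iff]
      exact not_le.1 hlt
    exact absurd this hTν.not_ge
  have hlik := ENNReal.mul_le_of_le_div hD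
  -- The factor `exp (-q_φ (k - 1))` occurs both in `P(φ = k)` and in the weight of no change, so it
  -- cancels and the requirement no longer involves `k`.
  have hreal : Real.exp (-qPhi ρ S * ν) ≤ α * (π₁.toReal * Real.exp (ν * (I - δ))) := by
    rw [← Real.exp_log hα, ← Real.exp_log hπ0, ← Real.exp_add, ← Real.exp_add, Real.exp_le_exp]
    have := mul_le_mul_of_nonneg_right hxν hδ
    linarith
  obtain ⟨k, rfl⟩ : ∃ k', k = k' + 1 := ⟨k - 1, by omega⟩
  have hpost := hω (k + 1) (k + 1 + ν - 1) (by omega) <| by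
    calc ENNReal.ofReal (Real.exp (-qPhi ρ S * (k + 1 + ν - 1 : ℕ))) *
          A.likInfty S (k + 1 + ν - 1) ω.2
        = ENNReal.ofReal (Real.exp (-qPhi ρ S * k)) * (ENNReal.ofReal (Real.exp (-qPhi ρ S * ν)) *
          A.likInfty S (k + 1 + ν - 1) ω.2) := by
          rw [← mul_assoc, ← ENNReal.ofReal_mul (Real.exp_pos _).le, ← Real.exp_add]
          congr 3
          rw [show k + 1 + ν - 1 = k + ν by omega]
          push_cast
          ring
      _ ≤ ENNReal.ofReal (Real.exp (-qPhi ρ S * k)) *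
          (ENNReal.ofReal (α * (π₁.toReal * Real.exp (ν * (I - δ)))) *
            A.likInfty S (k + 1 + ν - 1) ω.2) := by gcongr
      _ = ENNReal.ofReal α * (A.law (A.phiEq S hS (k + 1)) *
          (ENNReal.ofReal (Real.exp (ν * (I - δ))) * A.likInfty S (k + 1 + ν - 1) ω.2)) := by
          rw [ENNReal.ofReal_mul hα.le, ENNReal.ofReal_mul hπ0.le,
            ENNReal.ofReal_toReal (by finiteness), A.law_phiEq_succ S hS hρ]
          ring
      _ ≤ _ := by gcongr
  have htau : A.tau S hS α ω ≤ ((k + 1 + ν - 1 : ℕ) : ℕ∞) :=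
    (tau_le_iff S hS).2 ⟨_, by omega, le_rfl, hpost⟩
  have hsub : A.tau S hS α ω - ((k + 1 : ℕ) : ℕ∞) ≤ ((t + ⌈x⌉₊ : ℕ) : ℕ∞) := by
    rw [tsub_le_iff_right]
    refine htau.trans ?_
    exact_mod_cast (by omega)
  refine (ENat.toENNReal_le.2 hsub).trans ?_
  rw [ENat.toENNReal_coe, Nat.cast_add]
  gcongr
  rw [← ENNReal.ofReal_natCast]
  exact ENNReal.ofReal_le_of_le_toReal (Nat.floor_le ENNReal.toReal_nonneg)

theorem meanExcess_tau_le (hρ : A.GeometricPriors ρ) (hα : 0 < α) (hα1 : α ≤ 1)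
    (hinfo : A.info S ≠ ∞) {δ x : ℝ} (hδ : 0 ≤ qPhi ρ S + (A.info S).toReal - δ)
    (hx : -Real.log α - Real.log (A.law (A.phiEq S hS 1)).toReal ≤
      x * (qPhi ρ S + (A.info S).toReal - δ)) :
    A.meanExcess S hS (A.tau S hS α) ≤
      ∑' k, A.law (A.phiEq S hS k) * ∫⁻ ω, A.T S hS δ k ω ∂A.lawPhi S hS k + (⌈x⌉₊ : ℕ) := by
  have hae := ae_forall_le_posterior S hS hρ hα.le hα1
  have h1 : ((⌈x⌉₊ : ℕ) : ℝ≥0∞) = ∑' m, A.weight m * (⌈x⌉₊ : ℕ) := by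
    rw [ENNReal.tsum_mul_right, A.tsum_weight, one_mul]
  rw [meanExcess, lintegral_law, tsum_law_phiEq_mul_lintegral, h1, ← ENNReal.tsum_add]
  refine ENNReal.tsum_le_tsum fun m => ?_
  by_cases hm : A.weight m = 0
  · simp [hm]
  have hfst : ∀ᵐ ω ∂A.slice m, ω.1 = m :=
    (prob_compl_eq_zero_iff (A.measurableSet_fst (· = m))).2 (by simp [A.slice_fst (· = m)])
  have h2 : ∫⁻ _ : A.Sample, ((⌈x⌉₊ : ℕ) : ℝ≥0∞) ∂A.slice m = (⌈x⌉₊ : ℕ) := by simp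
  rw [← mul_add, ← h2, ← lintegral_add_right _ measurable_const]
  refine mul_le_mul_right (lintegral_mono_ae ?_) _
  filter_upwards [hfst, ae_slice_of_ae_law hae hm] with ω hω1 hω2
  rw [phi, hω1]
  exact tau_sub_le S hS hρ hα hinfo hω2 hδ hx (A.one_le_inf' S hS hm)

end ChangePoint.Model

/-! ### Asymptotics as `α` tends to zero. -/

theorem ENNReal.tendsto_tsum_zero_of_dominated {ι β : Type*} {l : Filter ι}
    [l.IsCountablyGenerated] [Countable β] {F : ι → β → ℝ≥0∞} {bound : β → ℝ≥0∞}
    (hb : ∑' k, bound k ≠ ∞) (hF : ∀ i k, F i k ≤ bound k)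
    (h : ∀ k, Tendsto (fun i => F i k) l (𝓝 0)) : Tendsto (fun i => ∑' k, F i k) l (𝓝 0) := by
  let _ : MeasurableSpace β := ⊤
  have := tendsto_lintegral_filter_of_dominated_convergence (μ := Measure.count) (l := l)
    (F := F) (f := fun _ => 0) bound
    (Eventually.of_forall fun i => Measurable.of_discrete)
    (Eventually.of_forall fun i => Eventually.of_forall (hF i))
    (by rwa [lintegral_count]) (Eventually.of_forall h)
  simpa [lintegral_count] using this

theorem Real.tendsto_abs_log_nhdsGT_zero : Tendsto (fun α : ℝ => |Real.log α|) (𝓝[>] 0) atTop :=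
  tendsto_abs_atBot_atTop.comp Real.tendsto_log_nhdsGT_zero

namespace ChangePoint.Model

variable {d : ℕ} {𝓧 : Type*} [MeasurableSpace 𝓧] {A : Model d 𝓧}
  {S : Finset (Fin d)} {hS : S.Nonempty} {ρ : Fin d → ℝ}
  {ε₀ c₁ : ℝ} {p : MvPolynomial (Option (Fin d)) ℝ} {q : Polynomial ℝ}

theorem lawPhi_le_one (k : ℕ) (B : Set A.Sample) : A.lawPhi S hS k B ≤ 1 := by
  refine (measure_mono (Set.subset_univ B)).trans ?_
  rw [lawPhi_apply A S hS k .univ]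
  simpa using A.tsum_piPhi_le S hS k

theorem eventually_nhdsGT_zero_mem_Ioo : ∀ᶠ α : ℝ in 𝓝[>] 0, α ∈ Set.Ioo (0 : ℝ) 1 :=
  Ioo_mem_nhdsGT one_pos

/-- Every rule with false alarm probability at most `α` has asymptotically at least the optimal
mean excess over `φ`. -/
theorem Concentrated.eventually_le_meanExcess (hconc : A.Concentrated S hS ε₀ c₁ p q)
    (hε₀ : 0 < ε₀) (hc₁ : 0 < c₁) (hinfo : 0 < A.info S) (hρ : A.GeometricPriors ρ) {ε : ℝ}
    (hε : 0 < ε) (hε1 : ε < 1) :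
    ∀ᶠ α : ℝ in 𝓝[>] 0, ∀ τ ∈ A.ruleClass S hS α,
      ENNReal.ofReal ((1 - ε) * (|Real.log α| / (qPhi ρ S + (A.info S).toReal))) ≤
        A.meanExcess S hS τ := by
  set I := (A.info S).toReal with hI_def
  have hq := A.qPhi_pos S hS hρ
  have hI : 0 ≤ I := ENNReal.toReal_nonneg
  set κ := qPhi ρ S + I with hκ_def
  have hκ : 0 < κ := by positivity
  set δ := ε / 4 with hδ_def
  have hδ : 0 < δ := by positivity
  have hδ1 : δ < 1 := by linarith
  let y : ℝ → ℝ := fun α => |Real.log α| / κ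
  have hy : Tendsto y (𝓝[>] 0) atTop := Real.tendsto_abs_log_nhdsGT_zero.atTop_div_const hκ
  let N : ℝ → ℕ := fun α => ⌊(1 - δ) * y α⌋₊
  have hN : Tendsto N (𝓝[>] 0) atTop :=
    tendsto_nat_floor_atTop.comp (hy.const_mul_atTop (by linarith))
  -- This is the bound of `lawPhi_stopping_le` with `c = N (1 + δ) I`; it does not depend on the
  -- rule `τ`.
  let u : ℝ → ℕ → ℝ≥0∞ := fun α k =>
    ENNReal.ofReal (α * Real.exp (N α * ((1 + δ) * I) + qPhi ρ S * (k + N α))) +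
      A.lawPhi S hS k {ω | ((N α * ((1 + δ) * I) : ℝ) : EReal) ≤
        ⨆ n ∈ Finset.Icc 1 (N α), ENNReal.log (A.D S hS k (k + n) ω)}
  have hu : ∀ k, Tendsto (fun α => u α k) (𝓝[>] 0) (𝓝 0) := by
    intro k
    have h1 : Tendsto (fun α => Real.exp (-(δ ^ 2 * |Real.log α|) + qPhi ρ S * k)) (𝓝[>] 0)
        (𝓝 0) := by
      refine Real.tendsto_exp_atBot.comp (tendsto_atBot_add_const_right _ _ ?_)
      exact tendsto_neg_atTop_atBot.comp
        (Real.tendsto_abs_log_nhdsGT_zero.const_mul_atTop (by positivity))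
    have h2 : Tendsto (fun α => α * Real.exp (N α * ((1 + δ) * I) + qPhi ρ S * (k + N α)))
        (𝓝[>] 0) (𝓝 0) := by
      refine tendsto_of_tendsto_of_tendsto_of_le_of_le' tendsto_const_nhds h1 ?_ ?_
      · filter_upwards [eventually_nhdsGT_zero_mem_Ioo] with α hα
        exact mul_nonneg hα.1.le (Real.exp_pos _).le
      · filter_upwards [eventually_nhdsGT_zero_mem_Ioo] with α hα
        have habs : |Real.log α| = -Real.log α := abs_of_neg (Real.log_neg hα.1 hα.2)
        have hNα : (N α : ℝ) * κ ≤ (1 - δ) * |Real.log α| := by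
          have h := Nat.floor_le (a := (1 - δ) * y α)
            (mul_nonneg (by linarith) (div_nonneg (abs_nonneg _) hκ.le))
          calc (N α : ℝ) * κ ≤ (1 - δ) * y α * κ := by gcongr
            _ = _ := by
              simp only [y]
              field_simp
        nth_rewrite 1 [← Real.exp_log hα.1]
        rw [← Real.exp_add, Real.exp_le_exp]
        have h3 : (N α : ℝ) * ((1 + δ) * I) + qPhi ρ S * N α ≤ (1 + δ) * (N α * κ) := by
          have : 0 ≤ δ * (N α * qPhi ρ S) := by positivity
          rw [hκ_def]
          linarith
        have h4 := mul_le_mul_of_nonneg_left hNα (by linarith : 0 ≤ 1 + δ)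
        -- The shortening `1 - δ` of the horizon beats the slack `1 + δ` in the threshold, leaving
        -- the exponent `-δ² |log α|`.
        have h5 : (1 + δ) * ((1 - δ) * |Real.log α|) = |Real.log α| - δ ^ 2 * |Real.log α| := by
          ring
        linarith
    have h3 := (hconc.tendsto_lawPhi_iSup_log_D hε₀ hc₁ hinfo hδ k).comp hN
    have h4 := ENNReal.tendsto_ofReal h2
    rw [ENNReal.ofReal_zero] at h4
    have h5 := h4.add h3
    rw [add_zero] at h5
    exact h5
  -- The convergence of `u` is only pointwise in `k`; capping at `1` gives the summable bound `P(φ =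
  -- k)`.
  let s : ℝ → ℝ≥0∞ := fun α => ∑' k, A.law (A.phiEq S hS k) * min 1 (u α k)
  have hs : Tendsto s (𝓝[>] 0) (𝓝 0) := by
    refine ENNReal.tendsto_tsum_zero_of_dominated (bound := fun k => A.law (A.phiEq S hS k))
      (by simp [A.tsum_law_phiEq]) (fun α k => mul_le_of_le_one_right' (min_le_left _ _))
      fun k => ?_
    have h : Tendsto (fun α => min 1 (u α k)) (𝓝[>] 0) (𝓝 0) :=
      tendsto_of_tendsto_of_tendsto_of_le_of_le tendsto_const_nhds (hu k)
        (fun _ => zero_le) fun _ => min_le_right _ _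
    simpa using ENNReal.Tendsto.const_mul h (Or.inr (measure_ne_top A.law (A.phiEq S hS k)))
  have hαs : Tendsto (fun α => ENNReal.ofReal α + s α) (𝓝[>] 0) (𝓝 0) := by
    have : Tendsto (fun α : ℝ => ENNReal.ofReal α) (𝓝[>] 0) (𝓝 0) := by
      have h := ENNReal.tendsto_ofReal (tendsto_nhdsWithin_of_tendsto_nhds (s := Set.Ioi 0)
        (tendsto_id (α := ℝ) (x := 𝓝 0)))
      simpa using h
    simpa using this.add hs
  have hαs' := hαs.eventually_lt_const (ENNReal.ofReal_pos.2 hδ)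
  filter_upwards [hαs', hy.eventually_ge_atTop (1 / (2 * δ)), eventually_nhdsGT_zero_mem_Ioo]
    with α hα hyα hα01 τ hτ
  have hP : A.law {ω | (A.phi S hS ω : ℕ∞) < τ ω ∧ τ ω ≤ (A.phi S hS ω : ℕ∞) + N α} ≤ s α := by
    rw [law_stopping_eq_tsum S hS hτ.1]
    refine ENNReal.tsum_le_tsum fun k => ?_
    gcongr
    refine le_min ?_ (lawPhi_stopping_le S hS hρ hτ k (N α) (N α * ((1 + δ) * I)))
    exact lawPhi_le_one k _
  have hcover : 1 ≤ ENNReal.ofReal α + s α +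
      A.law {ω | (A.phi S hS ω : ℕ∞) + N α < τ ω} := by
    have : (Set.univ : Set A.Sample) ⊆ ({ω | τ ω ≤ (A.phi S hS ω : ℕ∞)} ∪
        {ω | (A.phi S hS ω : ℕ∞) < τ ω ∧ τ ω ≤ (A.phi S hS ω : ℕ∞) + N α}) ∪
        {ω | (A.phi S hS ω : ℕ∞) + N α < τ ω} := by
      intro ω _
      rcases le_or_gt (τ ω) (A.phi S hS ω : ℕ∞) with h1 | h1
      · exact Or.inl (Or.inl h1)
      rcases le_or_gt (τ ω) ((A.phi S hS ω : ℕ∞) + N α) with h2 | h2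
      · exact Or.inl (Or.inr ⟨h1, h2⟩)
      · exact Or.inr h2
    rw [← measure_univ (μ := A.law)]
    refine (measure_mono this).trans ((measure_union_le _ _).trans ?_)
    gcongr
    exact (measure_union_le _ _).trans (add_le_add hτ.2 hP)
  have hlaw : ENNReal.ofReal (1 - δ) ≤ A.law {ω | (A.phi S hS ω : ℕ∞) + N α < τ ω} := by
    rw [ENNReal.ofReal_sub _ hδ.le, ENNReal.ofReal_one, tsub_le_iff_left]
    exact hcover.trans (by gcongr)
  refine le_trans ?_ ((mul_le_mul_right hlaw _).trans (mul_le_meanExcess S hS hτ.1 (N α)))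
  rw [← ENNReal.ofReal_natCast, ← ENNReal.ofReal_mul (by positivity)]
  refine ENNReal.ofReal_le_ofReal ?_
  have h1 : (1 - δ) * y α - 1 ≤ N α := (Nat.sub_one_lt_floor _).le
  have h2 : 1 ≤ 2 * δ * y α := by
    rw [div_le_iff₀ (by positivity)] at hyα
    linarith
  have h3 := mul_le_mul_of_nonneg_right h1 (by linarith : 0 ≤ 1 - δ)
  change (1 - ε) * y α ≤ _
  have h4 : 0 ≤ δ ^ 2 * y α := mul_nonneg (sq_nonneg δ) (div_nonneg (abs_nonneg _) hκ.le)
  have h5 : ε = 4 * δ := by rw [hδ_def]; ring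
  rw [h5]
  have h6 : ((1 - δ) * y α - 1) * (1 - δ) = (1 - 2 * δ) * y α + δ ^ 2 * y α - 1 + δ := by ring
  linarith

theorem UpperCondition.eventually_meanExcess_tau_le (hup : A.UpperCondition S hS)
    (hinfo : A.info S ≠ ∞) (hρ : A.GeometricPriors ρ) {ε : ℝ} (hε : 0 < ε) :
    ∀ᶠ α : ℝ in 𝓝[>] 0, A.meanExcess S hS (A.tau S hS α) ≤
      ENNReal.ofReal ((1 + ε) * (|Real.log α| / (qPhi ρ S + (A.info S).toReal))) := by
  set I := (A.info S).toReal with hI_def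
  have hq := A.qPhi_pos S hS hρ
  have hI : 0 ≤ I := ENNReal.toReal_nonneg
  set κ := qPhi ρ S + I with hκ_def
  have hκ : 0 < κ := by positivity
  set c := -Real.log (A.law (A.phiEq S hS 1)).toReal with hc
  -- Chosen so that the loss `δ = κ - η` in the rate costs exactly the factor `1 + ε / 2`; the other
  -- `ε / 2` absorbs the constants `K`, `|c| / η` and the rounding.
  set η := κ / (1 + ε / 2) with hη_def
  have hη : 0 < η := by positivity
  have hηκ : η < κ := div_lt_self hκ (by linarith)
  set K := ∑' k, A.law (A.phiEq S hS k) * ∫⁻ ω, A.T S hS (κ - η) k ω ∂A.lawPhi S hS k with hK_def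
  have hK : K ≠ ∞ := (hup (κ - η) (by linarith)).ne
  have hy : Tendsto (fun α => |Real.log α| / κ) (𝓝[>] 0) atTop :=
    Real.tendsto_abs_log_nhdsGT_zero.atTop_div_const hκ
  filter_upwards [eventually_nhdsGT_zero_mem_Ioo,
    hy.eventually_ge_atTop ((K.toReal + |c| / η + 1) / (ε / 2))] with α hα hyα
  have habs : |Real.log α| = -Real.log α := abs_of_neg (Real.log_neg hα.1 hα.2)
  set x := (|Real.log α| + |c|) / η with hx
  have hη' : κ - (κ - η) = η := by ring
  have h := meanExcess_tau_le S hS hρ hα.1 hα.2.le hinfo (δ := κ - η) (x := x)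
    (by rw [← hI_def, ← hκ_def, hη']; exact hη.le)
    (by
      rw [← hI_def, ← hκ_def, hη', hx, div_mul_cancel₀ _ hη.ne', habs]
      linarith [le_abs_self c])
  refine h.trans ?_
  rw [← hK_def, ← ENNReal.ofReal_toReal hK, ← ENNReal.ofReal_natCast,
    ← ENNReal.ofReal_add ENNReal.toReal_nonneg (by positivity)]
  refine ENNReal.ofReal_le_ofReal ?_
  have h1 : (⌈x⌉₊ : ℝ) ≤ x + 1 := (Nat.ceil_lt_add_one (by positivity)).le
  have h2 : x = (1 + ε / 2) * (|Real.log α| / κ) + |c| / η := by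
    rw [hx, add_div]
    congr 1
    rw [hη_def]
    field_simp
  rw [div_le_iff₀ (by positivity)] at hyα
  linarith

/-- The rule `τ_S + 1` links the two limits: it belongs to the class, so it bounds the infimum from
above, and as a member it transfers the lower bound to `τ_S` up to one time unit. Passing from mean
excess to delay costs at most the factor `1 / (1 - α)`. -/
theorem optimalDelay_of_bounds (hρ : A.GeometricPriors ρ)
    (hlow : ∀ ε : ℝ, 0 < ε → ε < 1 → ∀ᶠ α : ℝ in 𝓝[>] 0, ∀ τ ∈ A.ruleClass S hS α,
      ENNReal.ofReal ((1 - ε) * (|Real.log α| / (qPhi ρ S + (A.info S).toReal))) ≤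
        A.meanExcess S hS τ)
    (hup : ∀ ε : ℝ, 0 < ε → ∀ᶠ α : ℝ in 𝓝[>] 0, A.meanExcess S hS (A.tau S hS α) ≤
      ENNReal.ofReal ((1 + ε) * (|Real.log α| / (qPhi ρ S + (A.info S).toReal)))) :
    A.OptimalDelay ρ S hS := by
  have hq := A.qPhi_pos S hS hρ
  have hI : 0 ≤ (A.info S).toReal := ENNReal.toReal_nonneg
  set κ := qPhi ρ S + (A.info S).toReal with hκ_def
  have hκ : 0 < κ := by positivity
  have hy : Tendsto (fun α => |Real.log α| / κ) (𝓝[>] 0) atTop :=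
    Real.tendsto_abs_log_nhdsGT_zero.atTop_div_const hκ
  have hα0 : Tendsto (fun α : ℝ => α) (𝓝[>] 0) (𝓝 0) :=
    tendsto_nhdsWithin_of_tendsto_nhds tendsto_id
  have hlo : ∀ ε : ℝ, 0 < ε → ε < 1 → ∀ᶠ α : ℝ in 𝓝[>] 0,
      ENNReal.ofReal ((1 - ε) * (|Real.log α| / κ)) ≤ A.delay S hS (A.tau S hS α) ∧
      ENNReal.ofReal ((1 - ε) * (|Real.log α| / κ)) ≤
        ⨅ τ ∈ A.ruleClass S hS α, A.delay S hS τ := by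
    intro ε hε hε1
    filter_upwards [hlow (ε / 2) (by linarith) (by linarith), eventually_nhdsGT_zero_mem_Ioo,
      hy.eventually_ge_atTop (1 / (ε / 2))] with α hα hα01 hyα
    rw [div_le_iff₀ (by positivity)] at hyα
    have hτ := isStoppingTime_tau (A := A) (α := α) S hS
    constructor
    · have h1 := (hα _ (tau_add_one_mem_ruleClass S hS hα01.1.le)).trans
        (meanExcess_add_one_le S hS _)
      refine le_trans ?_ (meanExcess_le_delay S hS hτ)
      refine le_trans ?_ (tsub_le_iff_right.2 h1)
      rw [← ENNReal.ofReal_one, ← ENNReal.ofReal_sub _ zero_le_one]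
      exact ENNReal.ofReal_le_ofReal (by linarith)
    · refine le_iInf₂ fun τ hτ => ?_
      refine le_trans (ENNReal.ofReal_le_ofReal ?_)
        ((hα τ hτ).trans (meanExcess_le_delay S hS hτ.1))
      have : 0 ≤ |Real.log α| / κ := by positivity
      gcongr
      linarith
  have hhi : ∀ ε : ℝ, 0 < ε → ∀ᶠ α : ℝ in 𝓝[>] 0,
      A.delay S hS (A.tau S hS α) ≤ ENNReal.ofReal ((1 + ε) * (|Real.log α| / κ)) ∧
      ⨅ τ ∈ A.ruleClass S hS α, A.delay S hS τ ≤
        ENNReal.ofReal ((1 + ε) * (|Real.log α| / κ)) := by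
    intro ε hε
    -- The margin `ε` is split: `ε / 2` for the mean excess, `ε / 4` for the extra time unit, and
    -- the rest for the factor `1 / (1 - α)`.
    have hthr : 0 < 1 - (1 + 3 / 4 * ε) / (1 + ε) := by
      rw [sub_pos, div_lt_one (by linarith)]
      linarith
    filter_upwards [hup (ε / 2) (by linarith), eventually_nhdsGT_zero_mem_Ioo,
      hy.eventually_ge_atTop (1 / (ε / 4)), hα0.eventually_lt_const hthr] with α hα hα01 hyα hαε
    rw [div_le_iff₀ (by positivity)] at hyα
    have hτ := isStoppingTime_tau (A := A) (α := α) S hS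
    have hprob := one_sub_le_law_phi_le_tau (A := A) S hS hα01.1.le
    have hbound : (1 - ENNReal.ofReal α)⁻¹ * (A.meanExcess S hS (A.tau S hS α) + 1) ≤
        ENNReal.ofReal ((1 + ε) * (|Real.log α| / κ)) := by
      rw [← ENNReal.ofReal_one, ← ENNReal.ofReal_sub _ hα01.1.le,
        ← ENNReal.ofReal_inv_of_pos (by linarith [hα01.2])]
      have h1 : 0 < 1 - α := by linarith [hα01.2]
      have h2 : 0 ≤ |Real.log α| / κ := by positivity
      calc _ ≤ ENNReal.ofReal (1 - α)⁻¹ *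
            (ENNReal.ofReal ((1 + ε / 2) * (|Real.log α| / κ)) + ENNReal.ofReal 1) := by gcongr
        _ ≤ _ := by
          rw [← ENNReal.ofReal_add (by positivity) zero_le_one,
            ← ENNReal.ofReal_mul (by positivity)]
          refine ENNReal.ofReal_le_ofReal ?_
          rw [inv_mul_le_iff₀ h1]
          have h3 : 1 + 3 / 4 * ε ≤ (1 - α) * (1 + ε) := by
            rw [← div_le_iff₀ (by linarith)]
            linarith
          calc (1 + ε / 2) * (|Real.log α| / κ) + 1
              ≤ (1 + 3 / 4 * ε) * (|Real.log α| / κ) := by linarith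
            _ ≤ (1 - α) * (1 + ε) * (|Real.log α| / κ) := by gcongr
            _ = _ := by ring
    constructor
    · refine (delay_le S hS hτ hprob).trans (le_trans ?_ hbound)
      gcongr
      exact le_self_add
    · refine (iInf₂_le _ (tau_add_one_mem_ruleClass S hS hα01.1.le)).trans ?_
      refine (delay_le S hS (isStoppingTime_add_one hτ) (hprob.trans (measure_mono
        fun ω hω => ?_))).trans (le_trans ?_ hbound)
      · exact le_trans (b := A.tau S hS α ω) hω le_self_add
      · gcongr
        exact meanExcess_add_one_le S hS _
  have key : ∀ F : ℝ → ℝ≥0∞,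
      (∀ ε : ℝ, 0 < ε → ε < 1 → ∀ᶠ α : ℝ in 𝓝[>] 0,
        ENNReal.ofReal ((1 - ε) * (|Real.log α| / κ)) ≤ F α) →
      (∀ ε : ℝ, 0 < ε → ∀ᶠ α : ℝ in 𝓝[>] 0,
        F α ≤ ENNReal.ofReal ((1 + ε) * (|Real.log α| / κ))) →
      Tendsto (fun α => F α / ENNReal.ofReal (|Real.log α| / κ)) (𝓝[>] 0) (𝓝 1) := by
    intro F h1 h2
    refine tendsto_order.2 ⟨fun a ha => ?_, fun a ha => ?_⟩
    · obtain ⟨b, hb0, rfl⟩ : ∃ b : ℝ, 0 ≤ b ∧ a = ENNReal.ofReal b :=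
        ⟨a.toReal, ENNReal.toReal_nonneg, (ENNReal.ofReal_toReal ha.ne_top).symm⟩
      rw [ENNReal.ofReal_lt_one] at ha
      filter_upwards [h1 ((1 - b) / 2) (by linarith) (by linarith),
        hy.eventually_gt_atTop 0] with α hα hyα
      rw [ENNReal.lt_div_iff_mul_lt (Or.inl (ENNReal.ofReal_pos.2 hyα).ne')
        (Or.inl ENNReal.ofReal_ne_top)]
      refine lt_of_lt_of_le ?_ hα
      rw [← ENNReal.ofReal_mul hb0]
      refine (ENNReal.ofReal_lt_ofReal_iff (mul_pos (by linarith) hyα)).2 ?_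
      exact mul_lt_mul_of_pos_right (by linarith) hyα
    · obtain ⟨b, hb1, hba⟩ := exists_between ha
      have hbfin : b ≠ ∞ := hba.ne_top
      have hb1' : 1 < b.toReal := by
        rw [← ENNReal.toReal_one]
        exact (ENNReal.toReal_lt_toReal ENNReal.one_ne_top hbfin).2 hb1
      filter_upwards [h2 (b.toReal - 1) (by linarith), hy.eventually_gt_atTop 0] with α hα hyα
      refine lt_of_le_of_lt ?_ hba
      rw [ENNReal.div_le_iff (ENNReal.ofReal_pos.2 hyα).ne' ENNReal.ofReal_ne_top]
      refine hα.trans_eq ?_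
      rw [add_sub_cancel, ENNReal.ofReal_mul (by linarith), ENNReal.ofReal_toReal hbfin]
  exact ⟨key _ (fun ε h h' => (hlo ε h h').mono fun _ => And.left)
      fun ε h => (hhi ε h).mono fun _ => And.left,
    key _ (fun ε h h' => (hlo ε h h').mono fun _ => And.right)
      fun ε h => (hhi ε h).mono fun _ => And.right⟩

end ChangePoint.Model

theorem mainTheorem3 {d : ℕ} {𝓧 : Type*} [MeasurableSpace 𝓧] (A : ChangePoint.Model d 𝓧)
    (S : Finset (Fin d)) (hS : S.Nonempty) (hinfo : 0 < A.info S)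
    (ε₀ c₁ : ℝ) (hε₀ : 0 < ε₀) (hc₁ : 0 < c₁)
    -- the variables of `p` are `m_1, …, m_d` and, as `none`, `k`
    (p : MvPolynomial (Option (Fin d)) ℝ) (hp : ∀ s, 0 ≤ p.coeff s)
    (q : Polynomial ℝ) (hq : ∀ i, 0 ≤ q.coeff i)
    (hconc : ∀ (k : ℕ) (m : Fin d → ℕ), 0 < A.piPhi S hS k m →
      ∀ n : ℕ, 1 ≤ n → ∀ ε : ℝ, 0 < ε → ε < ε₀ →
      1 / ε * p.eval (fun o => o.elim (k : ℝ) (fun j => (m j : ℝ))) ≤ √(n : ℝ) →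
      A.lawLam m {ω | ENNReal.ofReal ε <
          (ENNReal.log (A.D S hS k n ω) / ((n : ℝ) : EReal) - (A.info S : EReal)).abs} ≤
        ENNReal.ofReal (q.eval (n : ℝ) * Real.exp (-c₁ * n * ε ^ 2)))
    (hpi : A.PiPhiMoments S hS) (hphi : A.PhiMoments S hS) :
    A.LowerCondition S hS ∧ A.UpperCondition S hS ∧
      ∀ (ρ : Fin d → ℝ) (M : ℝ), A.GeometricPriors ρ → A.BoundedLLR M →
        A.OptimalDelay ρ S hS := by
  have hconc' : A.Concentrated S hS ε₀ c₁ p q := hconc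
  have hfin := hconc'.info_ne_top hε₀ hc₁
  have hup := hconc'.upperCondition hε₀ hc₁ hinfo hpi hphi
  exact ⟨hconc'.lowerCondition hε₀ hc₁ hinfo, hup, fun ρ _ hρ _ =>
    ChangePoint.Model.optimalDelay_of_bounds hρ
      (fun _ h h' => hconc'.eventually_le_meanExcess hε₀ hc₁ hinfo hρ h h')
      fun _ h => hup.eventually_meanExcess_tau_le hfin hρ h⟩
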